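/- For a complex Hilbert space $H$ let $B(H)_+\subseteq B(H)_{\mathrm{sa}}$ be the positive and the self-adjoint bounded operators on $H$. Let $\Phi$ be an operation giving, for each complex Hilbert space $H$, a map $\Phi_H:B(H)_+\times B(H)_+\to B(H)_{\mathrm{sa}}$. We say that $\Phi$ is *operator homogeneous* if for all Hilbert spaces $H,K$, all $A,B\in B(H)_+$ and every bounded operator $C:K\to H$ with $\overline{\operatorname{ran}}(A+B)\subseteq\overline{\operatorname{ran}}\,C$, $$\Phi_K(C^*AC,\,C^*BC)=C^*\,\Phi_H(A,B)\,C .$$ A function $\phi:[0,\infty)^2\to\mathbb R$ is *homogeneous* if $\phi(\lambda x,\lambda y)=\lambda\phi(x,y)$ for all $\lambda,x,y\ge0$. For $\phi$ homogeneous and continuous, $\Phi$ is the *Pusz–Woronowicz (PW) functional calculus associated with $\phi$* if $\Phi$ is operator homogeneous and, for every $H$ and every commuting pair $A,B\in B(H)_+$, $\Phi_H(A,B)$ is given by the usual functional calculus, i.e. $\Phi_H(A,B)=\int\phi(x,y)\,dE_{(A,B)}(x,y)$ with the joint spectral measure $E_{(A,B)}$ of $(A,B)$. **Theorem 10.1.**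 The operation $\Phi$ satisfies (a) $\Phi$ is operator homogeneous; (b) whenever $H=\bigoplus_{i\in I}H_i$ is a Hilbert space direct sum over any index set, $A,B\in B(H)_+$, $A=\bigoplus_iA_i$ and $B=\bigoplus_iB_i$ with $A_i,B_i\in B(H_i)_+$, one has $\Phi_H(A,B)=\bigoplus_i\Phi_{H_i}(A_i,B_i)$; (c) for each $H$, if $A,B,A_n,B_n\in B(H)_+$ ($n\in\mathbb N$), $A_n\to A$ and $B_n\to B$ in the strong operator topology (SOT), and $A_n+B_n\ge\varepsilon I$ for all $n$ with some $\varepsilon>0$, then $\Phi_H(A_n,B_n)\to\Phi_H(A,B)$ in SOT; (d) for each $H$ and all $A,B\in B(H)_+$, $\Phi_H(A+\varepsilon I,B+\varepsilon I)\to\Phi_H(A,B)$ in SOT as $\varepsilon\searrow0$; if and only if there exists a homogeneous continuous function $\phi:[0,\infty)^2\to\mathbb R$ such that $\Phi$ is the PW-functional calculus associated with $\phi$. Moreover, such a $\phi$ is unique if it exists. -/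

import Mathlib

open Filter Topology
open scoped NNReal

universe u

namespace PW

/-- `B(H)₊`: the positive bounded operators on the Hilbert space `H`. -/
abbrev PosOp (H : Type u) [NormedAddCommGroup H] [InnerProductSpace ℂ H] [CompleteSpace H] :
    Type u :=
  {A : H →L[ℂ] H // A.IsPositive}

/-- `B(H)_sa`: the self-adjoint bounded operators on the Hilbert space `H`. -/
abbrev SaOp (H : Type u) [NormedAddCommGroup H] [InnerProductSpace ℂ H] [CompleteSpace H] :
    Type u :=
  {A : H →L[ℂ] H // IsSelfAdjoint A}

/-- An operation giving, for each complex Hilbert space `H`, a map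
`B(H)₊ × B(H)₊ → B(H)_sa`. -/
abbrev Operation : Type (u + 1) :=
  ∀ (H : Type u) [NormedAddCommGroup H] [InnerProductSpace ℂ H] [CompleteSpace H],
    PosOp H → PosOp H → SaOp H

section Operators

variable {H : Type u} [NormedAddCommGroup H] [InnerProductSpace ℂ H] [CompleteSpace H]
variable {K : Type u} [NormedAddCommGroup K] [InnerProductSpace ℂ K] [CompleteSpace K]

/-- The positive operator `C* A C` on `K`, for `A ∈ B(H)₊` and a bounded operator `C : K → H`. -/
noncomputable def PosOp.conj (A : PosOp H) (C : K →L[ℂ] H) : PosOp K :=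
  ⟨ContinuousLinearMap.adjoint C ∘L A.1 ∘L C, A.2.adjoint_conj C⟩

/-- The positive operator `A + ε I`, for `A ∈ B(H)₊` and `ε ≥ 0`. -/
noncomputable def PosOp.shift (A : PosOp H) (ε : ℝ≥0) : PosOp H :=
  ⟨A.1 + ((ε : ℝ) : ℂ) • (1 : H →L[ℂ] H),
    A.2.add (ContinuousLinearMap.IsPositive.smul_of_nonneg
      ContinuousLinearMap.isPositive_one (by exact_mod_cast ε.2))⟩

/-- Convergence in the strong operator topology along a filter. -/
def TendstoSOT {ι : Type*} (T : ι → H →L[ℂ] H) (l : Filter ι) (S : H →L[ℂ] H) : Prop :=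
  ∀ ξ : H, Tendsto (fun i => T i ξ) l (𝓝 (S ξ))

/-- The usual functional calculus `φ(A, B) = ∫ φ(x, y) dE(x, y)` of a *commuting* pair of positive
operators `A, B` with joint spectral measure `E`, for a continuous function `φ` on `[0, ∞)²`.
As `A` and `B` commute, `A + iB` is normal, and `E` is its spectral measure when `ℂ` is identified
with `ℝ²` through `z = x + iy`; so `φ(A, B)` is the continuous functional calculus of `A + iB`
at the function `x + iy ↦ φ(x, y)`. On the spectrum of `A + iB` one has `x, y ≥ 0`, so
`Real.toNNReal` only changes the type there. -/
noncomputable def jointCalculus (φ : ℝ≥0 × ℝ≥0 → ℝ) (A B : PosOp H) : H →L[ℂ] H :=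
  cfc (fun z : ℂ => ((φ (z.re.toNNReal, z.im.toNNReal) : ℝ) : ℂ)) (A.1 + Complex.I • B.1)

end Operators

/-- Operator homogeneity: `Φ(C* A C, C* B C) = C* Φ(A, B) C` for every bounded operator
`C : K → H` such that the closure of the range of `A + B` is contained in that of `C`. -/
def OperatorHomogeneous (Φ : Operation.{u}) : Prop :=
  ∀ (H : Type u) [NormedAddCommGroup H] [InnerProductSpace ℂ H] [CompleteSpace H]
    (K : Type u) [NormedAddCommGroup K] [InnerProductSpace ℂ K] [CompleteSpace K]
    (A B : PosOp H) (C : K →L[ℂ] H),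
    closure (Set.range (A.1 + B.1)) ⊆ closure (Set.range C) →
      (Φ K (A.conj C) (B.conj C)).1 =
        ContinuousLinearMap.adjoint C ∘L (Φ H A B).1 ∘L C

/-- Compatibility with direct sums: if `H = ⨁ᵢ Hᵢ` (a Hilbert space direct sum of any family of
Hilbert spaces, with embeddings `V i : Hᵢ → H`), `A = ⨁ᵢ Aᵢ` and `B = ⨁ᵢ Bᵢ`, then
`Φ(A, B) = ⨁ᵢ Φ(Aᵢ, Bᵢ)`. A bounded operator `T` is `⨁ᵢ Tᵢ` if `T (V i x) = V i (Tᵢ x)` for all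
`i` and `x`. -/
def RespectsDirectSums (Φ : Operation.{u}) : Prop :=
  ∀ (H : Type u) [NormedAddCommGroup H] [InnerProductSpace ℂ H] [CompleteSpace H]
    (ι : Type u) (G : ι → Type u) [∀ i, NormedAddCommGroup (G i)]
    [∀ i, InnerProductSpace ℂ (G i)] [∀ i, CompleteSpace (G i)]
    (V : ∀ i, G i →ₗᵢ[ℂ] H), IsHilbertSum ℂ G V →
    ∀ (A B : PosOp H) (A' B' : ∀ i, PosOp (G i)),
      (∀ i x, A.1 (V i x) = V i ((A' i).1 x)) →
      (∀ i x, B.1 (V i x) = V i ((B' i).1 x)) →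
      ∀ i x, (Φ H A B).1 (V i x) = V i ((Φ (G i) (A' i) (B' i)).1 x)

/-- Sequential SOT-continuity on pairs whose sums are uniformly bounded below: if `Aₙ → A` and
`Bₙ → B` in SOT and `Aₙ + Bₙ ≥ ε I` for all `n` with some `ε > 0`, then `Φ(Aₙ, Bₙ) → Φ(A, B)`
in SOT. -/
def SOTContinuousBoundedBelow (Φ : Operation.{u}) : Prop :=
  ∀ (H : Type u) [NormedAddCommGroup H] [InnerProductSpace ℂ H] [CompleteSpace H]
    (A B : PosOp H) (An Bn : ℕ → PosOp H) (ε : ℝ), 0 < ε →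
    TendstoSOT (fun n => (An n).1) atTop A.1 →
    TendstoSOT (fun n => (Bn n).1) atTop B.1 →
    (∀ n, (ε : ℂ) • (1 : H →L[ℂ] H) ≤ (An n).1 + (Bn n).1) →
    TendstoSOT (fun n => (Φ H (An n) (Bn n)).1) atTop (Φ H A B).1

/-- `Φ(A + ε I, B + ε I) → Φ(A, B)` in SOT as `ε ↘ 0`. -/
def ShiftContinuous (Φ : Operation.{u}) : Prop :=
  ∀ (H : Type u) [NormedAddCommGroup H] [InnerProductSpace ℂ H] [CompleteSpace H]
    (A B : PosOp H),
    TendstoSOT (fun ε : ℝ≥0 => (Φ H (A.shift ε) (B.shift ε)).1) (𝓝[>] 0) (Φ H A B).1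

/-- Homogeneity of a function on `[0, ∞)²`. -/
def Homogeneous (φ : ℝ≥0 × ℝ≥0 → ℝ) : Prop :=
  ∀ c x y : ℝ≥0, φ (c * x, c * y) = c * φ (x, y)

/-- The operation `Φ` is the Pusz-Woronowicz functional calculus associated with the real-valued
continuous homogeneous function `φ`: it extends the usual functional calculus of commuting pairs
and is operator homogeneous. -/
structure IsPWCalculus (φ : ℝ≥0 × ℝ≥0 → ℝ) (Φ : Operation.{u}) : Prop where
  extends_usual : ∀ (H : Type u) [NormedAddCommGroup H] [InnerProductSpace ℂ H] [CompleteSpace H]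
    (A B : PosOp H), Commute A.1 B.1 → (Φ H A B).1 = jointCalculus φ A B
  homogeneous : OperatorHomogeneous Φ

end PW

/-! Put D = (A + B)^{1/2} and let P be its range projection. Douglas' lemma gives A = DRD and B =
DSD with R, S positive, supported on P, and R + S = P. Then S = P - R commutes with R, and operator
homogeneity with C = D forces Φ(A, B) = D φ(R, S) D. Every property of a PW-calculus is thus a
property of the functional calculus of commuting pairs. Direct sums: whatever intertwines two pairs
also intertwines D, P, R, S, hence Φ. Continuity under A + B ≥ ε: here R = D⁻¹AD⁻¹, and square
roots, uniformly bounded inverses and continuous functional calculus are strongly continuous along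
bounded sequences. Shifts: the factors of (A + ε, B + ε) tend to R + (1 - P)/2 and S + (1 - P)/2,
and the extra terms disappear between the two outer D's.

Conversely, Φ on scalars of a one-dimensional space defines φ. Homogeneity of Φ makes φ homogeneous;
(c) makes it continuous off the origin, and homogeneity settles the origin. By (a) and (b), Φ is
compatible with intertwining isometries, so it acts correctly on common eigenvectors, hence on pairs
with R + S = 1 and R compact. Finite-rank compressions on cyclic subspaces together with (c) remove
compactness. Conjugation by (A + B)^{-1/2} then handles commuting pairs with A + B ≥ ε, and (d)
handles all commuting pairs. Uniqueness is read off from scalars. The carrying lemmas are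
`exists_isFactorization`, `IsPWCalculus.comp_eq_comp`, `IsPWCalculus.tendstoSOT_shift_seq` and
`apply_eq_jointCalculus_of_add_eq_one`. -/

namespace PW

/-! ### Stone–Weierstrass approximation -/

section Approximation

/-- Stone–Weierstrass as an induction principle: polynomials in z and its conjugate are dense in
C(s), and `p` passes from the generators to all of them. The approximant is continuous on all of ℂ,
so it can be applied to every operator with spectrum in s. -/
theorem exists_approx_of_closed_under_star_algebra {s : Set ℂ} (hs : IsCompact s)
    (p : (ℂ → ℂ) → Prop) (const : ∀ c : ℂ, p fun _ => c) (id : p fun z => z)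
    (star : ∀ f, Continuous f → p f → p fun z => star (f z))
    (add : ∀ f g, Continuous f → Continuous g → p f → p g → p fun z => f z + g z)
    (mul : ∀ f g, Continuous f → Continuous g → p f → p g → p fun z => f z * g z)
    {f : ℂ → ℂ} (hf : ContinuousOn f s) {ε : ℝ} (hε : 0 < ε) :
    ∃ g, Continuous g ∧ p g ∧ ∀ z ∈ s, ‖f z - g z‖ ≤ ε := by
  have : CompactSpace s := isCompact_iff_compactSpace.mp hs
  let F : C(s, ℂ) := ⟨s.domRestrict f, hf.domRestrict⟩
  have hF : F ∈ StarAlgebra.elemental ℂ (ContinuousMap.restrict s (.id ℂ)) := by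
    rw [ContinuousMap.elemental_id_eq_top]; trivial
  have hF' : F ∈ closure (StarAlgebra.adjoin ℂ {ContinuousMap.restrict s (.id ℂ)} : Set C(s, ℂ)) :=
    hF
  obtain ⟨G, hG, hFG⟩ := Metric.mem_closure_iff.mp hF' ε hε
  have key : ∃ g : ℂ → ℂ, Continuous g ∧ p g ∧ ∀ z : s, G z = g z := by
    clear hFG
    induction hG using StarAlgebra.adjoin_induction with
    | mem x hx =>
      rw [Set.mem_singleton_iff] at hx
      exact ⟨fun z => z, continuous_id, id, fun z => by rw [hx]; rfl⟩
    | algebraMap r => exact ⟨fun _ => r, continuous_const, const r, fun z => rfl⟩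
    | add x y _ _ hx hy =>
      obtain ⟨a, ha, hpa, hxa⟩ := hx
      obtain ⟨b, hb, hpb, hyb⟩ := hy
      exact ⟨_, ha.add hb, add a b ha hb hpa hpb, fun z => by simp [hxa, hyb]⟩
    | mul x y _ _ hx hy =>
      obtain ⟨a, ha, hpa, hxa⟩ := hx
      obtain ⟨b, hb, hpb, hyb⟩ := hy
      exact ⟨_, ha.mul hb, mul a b ha hb hpa hpb, fun z => by simp [hxa, hyb]⟩
    | star x _ hx =>
      obtain ⟨a, ha, hpa, hxa⟩ := hx
      exact ⟨_, ha.star, star a ha hpa, fun z => by simp [hxa]⟩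
  obtain ⟨g, hg, hpg, hGg⟩ := key
  refine ⟨g, hg, hpg, fun z hz => ?_⟩
  have h := (ContinuousMap.dist_lt_iff hε).mp hFG ⟨z, hz⟩
  rw [hGg, dist_eq_norm] at h
  exact h.le

end Approximation

/-! ### Intertwiners and the continuous functional calculus -/

section Calculus

variable {H K : Type*} [NormedAddCommGroup H] [InnerProductSpace ℂ H] [CompleteSpace H]
  [NormedAddCommGroup K] [InnerProductSpace ℂ K] [CompleteSpace K]

theorem norm_cfc_sub_cfc_le {s : Set ℂ} {N : H →L[ℂ] H} (hN : spectrum ℂ N ⊆ s)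
    {f g : ℂ → ℂ} (hf : ContinuousOn f s) (hg : Continuous g)
    {ε : ℝ} (hε : 0 ≤ ε) (h : ∀ z ∈ s, ‖f z - g z‖ ≤ ε) : ‖cfc f N - cfc g N‖ ≤ ε := by
  rw [← cfc_sub f g N (hf.mono hN) hg.continuousOn]
  exact norm_cfc_le hε fun z hz => h z (hN hz)

/-- An operator intertwining two normal operators and their adjoints intertwines their continuous
functional calculi. -/
theorem cfc_comp_eq_comp_cfc {N : H →L[ℂ] H} {M : K →L[ℂ] K} [IsStarNormal N] [IsStarNormal M]
    {W : K →L[ℂ] H} (h : N ∘L W = W ∘L M) (h' : star N ∘L W = W ∘L star M) {f : ℂ → ℂ}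
    (hf : Continuous f) : cfc f N ∘L W = W ∘L cfc f M := by
  let s := spectrum ℂ N ∪ spectrum ℂ M
  have hs : IsCompact s := (spectrum.isCompact N).union (spectrum.isCompact M)
  -- The second conjunct makes `p` stable under conjugation.
  let p : (ℂ → ℂ) → Prop := fun g => cfc g N ∘L W = W ∘L cfc g M ∧
    cfc (fun z => star (g z)) N ∘L W = W ∘L cfc (fun z => star (g z)) M
  have hp : ∀ ε > 0, ‖cfc f N ∘L W - W ∘L cfc f M‖ ≤ ε := by
    intro ε hε
    obtain ⟨δ, hδ, hδε⟩ : ∃ δ > 0, δ * ‖W‖ + ‖W‖ * δ ≤ ε := by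
      refine ⟨ε / (2 * ‖W‖ + 1), by positivity, ?_⟩
      rw [show ε / (2 * ‖W‖ + 1) * ‖W‖ + ‖W‖ * (ε / (2 * ‖W‖ + 1))
        = ε * (2 * ‖W‖) / (2 * ‖W‖ + 1) by ring, div_le_iff₀ (by positivity)]
      nlinarith
    obtain ⟨g, hg, ⟨hpg, -⟩, hfg⟩ := exists_approx_of_closed_under_star_algebra hs p
      (fun c => by
        constructor <;>
        · simp only [cfc_const _ N, cfc_const _ M]
          ext x; simp [Algebra.algebraMap_eq_smul_one])
      (by
        constructor
        · simpa only [cfc_id' ℂ N, cfc_id' ℂ M] using h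
        · simpa only [cfc_star_id (R := ℂ) N, cfc_star_id (R := ℂ) M] using h')
      (fun g hg hpg => ⟨hpg.2, by simpa only [star_star] using hpg.1⟩)
      (fun a b ha hb hpa hpb => by
        have ha' := ha.star
        have hb' := hb.star
        constructor
        · rw [cfc_add N a b, cfc_add M a b, ContinuousLinearMap.add_comp,
            ContinuousLinearMap.comp_add, hpa.1, hpb.1]
        · simp only [star_add]
          rw [cfc_add N (fun z => star (a z)) (fun z => star (b z)),
            cfc_add M (fun z => star (a z)) (fun z => star (b z)), ContinuousLinearMap.add_comp,
            ContinuousLinearMap.comp_add, hpa.2, hpb.2])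
      (fun a b ha hb hpa hpb => by
        have ha' := ha.star
        have hb' := hb.star
        constructor
        · rw [cfc_mul a b N, cfc_mul a b M, ContinuousLinearMap.mul_def,
            ContinuousLinearMap.mul_def, ContinuousLinearMap.comp_assoc, hpb.1,
            ← ContinuousLinearMap.comp_assoc, hpa.1, ContinuousLinearMap.comp_assoc]
        · simp only [star_mul']
          rw [cfc_mul (fun z => star (a z)) (fun z => star (b z)) N,
            cfc_mul (fun z => star (a z)) (fun z => star (b z)) M, ContinuousLinearMap.mul_def,
            ContinuousLinearMap.mul_def, ContinuousLinearMap.comp_assoc, hpb.2,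
            ← ContinuousLinearMap.comp_assoc, hpa.2, ContinuousLinearMap.comp_assoc])
      (f := f) hf.continuousOn hδ
    have e : cfc f N ∘L W - W ∘L cfc f M
        = (cfc f N - cfc g N) ∘L W - W ∘L (cfc f M - cfc g M) := by
      rw [ContinuousLinearMap.sub_comp, ContinuousLinearMap.comp_sub, hpg]; abel
    rw [e]
    refine (norm_sub_le _ _).trans (le_trans (add_le_add
      ((ContinuousLinearMap.opNorm_comp_le _ _).trans (mul_le_mul_of_nonneg_right
        (norm_cfc_sub_cfc_le Set.subset_union_left hf.continuousOn hg hδ.le hfg) (norm_nonneg _)))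
      ((ContinuousLinearMap.opNorm_comp_le _ _).trans (mul_le_mul_of_nonneg_left
        (norm_cfc_sub_cfc_le Set.subset_union_right hf.continuousOn hg hδ.le hfg)
          (norm_nonneg _)))) hδε)
  rw [← sub_eq_zero, ← norm_le_zero_iff]
  exact le_of_forall_pos_le_add fun ε hε => by simpa using hp ε hε

end Calculus

/-! ### Strong continuity of the functional calculus -/

section SOT

variable {H : Type u} [NormedAddCommGroup H] [InnerProductSpace ℂ H]
variable {ι : Type*} {l : Filter ι}

theorem TendstoSOT.add {S T : ι → H →L[ℂ] H} {S' T' : H →L[ℂ] H} (hS : TendstoSOT S l S')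
    (hT : TendstoSOT T l T') : TendstoSOT (fun i => S i + T i) l (S' + T') :=
  fun x => (hS x).add (hT x)

theorem TendstoSOT.sub {S T : ι → H →L[ℂ] H} {S' T' : H →L[ℂ] H} (hS : TendstoSOT S l S')
    (hT : TendstoSOT T l T') : TendstoSOT (fun i => S i - T i) l (S' - T') :=
  fun x => (hS x).sub (hT x)

theorem TendstoSOT.const_smul {T : ι → H →L[ℂ] H} {T' : H →L[ℂ] H} (c : ℂ)
    (hT : TendstoSOT T l T') : TendstoSOT (fun i => c • T i) l (c • T') :=
  fun x => (hT x).const_smul c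

theorem tendstoSOT_const (T : H →L[ℂ] H) : TendstoSOT (fun _ : ι => T) l T :=
  fun _ => tendsto_const_nhds

/-- Multiplication is strongly continuous only when the left factors stay bounded, which controls S
i (T i x - T' x). -/
theorem TendstoSOT.mul {S T : ι → H →L[ℂ] H} {S' T' : H →L[ℂ] H} (hS : TendstoSOT S l S')
    (hT : TendstoSOT T l T') {r : ℝ} (hr : ∀ i, ‖S i‖ ≤ r) :
    TendstoSOT (fun i => S i * T i) l (S' * T') := by
  intro x
  have h1 : Tendsto (fun i => S i (T i x - T' x)) l (𝓝 0) := by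
    refine squeeze_zero_norm (a := fun i => r * ‖T i x - T' x‖)
      (fun i => (S i).le_of_opNorm_le (hr i) _) ?_
    have := ((hT x).sub_const (T' x)).norm.const_mul r
    simpa using this
  have h2 := h1.add (hS (T' x))
  simpa using h2

variable [CompleteSpace H]

/-- All spectra lie in one disc, where f is uniformly close to a polynomial in z and its conjugate.
For these, convergence follows from that of N i and of the adjoints, the products being controlled
by uniform bounds. -/
theorem tendstoSOT_cfc {N : ι → H →L[ℂ] H} {M : H →L[ℂ] H} (hN : ∀ i, IsStarNormal (N i))
    (hM : IsStarNormal M) {r : ℝ} (hNr : ∀ i, ‖N i‖ ≤ r) (hMr : ‖M‖ ≤ r)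
    (h : TendstoSOT N l M) (h' : TendstoSOT (fun i => star (N i)) l (star M)) {f : ℂ → ℂ}
    (hf : Continuous f) : TendstoSOT (fun i => cfc f (N i)) l (cfc f M) := by
  cases subsingleton_or_nontrivial H with
  | inl hs => intro x; simp [Subsingleton.elim _ (0 : H)]
  | inr hs =>
  let s := Metric.closedBall (0 : ℂ) r
  have hs : IsCompact s := isCompact_closedBall _ _
  have hNs : ∀ i, spectrum ℂ (N i) ⊆ s := fun i =>
    (spectrum.subset_closedBall_norm (N i)).trans (Metric.closedBall_subset_closedBall (hNr i))
  have hMs : spectrum ℂ M ⊆ s :=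
    (spectrum.subset_closedBall_norm M).trans (Metric.closedBall_subset_closedBall hMr)
  have hbd : ∀ g : ℂ → ℂ, Continuous g → ∃ C, ∀ i, ‖cfc g (N i)‖ ≤ C := by
    intro g hg
    obtain ⟨C, hC⟩ := hs.exists_bound_of_continuousOn hg.continuousOn
    exact ⟨max C 0, fun i => norm_cfc_le (le_max_right _ _)
      fun z hz => (hC z (hNs i hz)).trans (le_max_left _ _)⟩
  let p : (ℂ → ℂ) → Prop := fun g => TendstoSOT (fun i => cfc g (N i)) l (cfc g M) ∧
    TendstoSOT (fun i => cfc (fun z => star (g z)) (N i)) l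
      (cfc (fun z => star (g z)) M)
  intro x
  rw [Metric.tendsto_nhds]
  intro ε hε
  obtain ⟨δ, hδ, hδε⟩ : ∃ δ > 0, δ * ‖x‖ + δ * ‖x‖ < ε / 2 := by
    refine ⟨ε / 2 / (2 * ‖x‖ + 1), by positivity, ?_⟩
    rw [show ε / 2 / (2 * ‖x‖ + 1) * ‖x‖ + ε / 2 / (2 * ‖x‖ + 1) * ‖x‖
      = ε / 2 * (2 * ‖x‖) / (2 * ‖x‖ + 1) by ring, div_lt_iff₀ (by positivity)]
    nlinarith
  obtain ⟨g, hg, ⟨hpg, -⟩, hfg⟩ := exists_approx_of_closed_under_star_algebra hs p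
      (fun c => by
        constructor
        · simp only [cfc_const c M, fun i => cfc_const c (N i) (hN i)]
          exact tendstoSOT_const _
        · simp only [cfc_const (star c) M, fun i => cfc_const (star c) (N i) (hN i)]
          exact tendstoSOT_const _)
      (by
        constructor
        · simpa only [cfc_id' ℂ M, fun i => cfc_id' ℂ (N i) (hN i)] using h
        · simpa only [cfc_star_id (R := ℂ) M, fun i => cfc_star_id (R := ℂ) (N i) (hN i)] using h')
      (fun g hg hpg => ⟨hpg.2, by simpa only [star_star] using hpg.1⟩)
      (fun a b ha hb hpa hpb => by
        have ha' := ha.star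
        have hb' := hb.star
        constructor
        · simp only [cfc_add M a b, fun i => cfc_add (N i) a b]
          exact hpa.1.add hpb.1
        · simp only [star_add]
          simp only [cfc_add M (fun z => star (a z)) (fun z => star (b z)),
            fun i => cfc_add (N i) (fun z => star (a z)) (fun z => star (b z))]
          exact hpa.2.add hpb.2)
      (fun a b ha hb hpa hpb => by
        have ha' := ha.star
        have hb' := hb.star
        constructor
        · simp only [cfc_mul a b M, fun i => cfc_mul a b (N i)]
          exact hpa.1.mul hpb.1 (hbd a ha).choose_spec
        · simp only [star_mul']
          simp only [cfc_mul (fun z => star (a z)) (fun z => star (b z)) M,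
            fun i => cfc_mul (fun z => star (a z)) (fun z => star (b z)) (N i)]
          exact hpa.2.mul hpb.2 (hbd _ ha').choose_spec)
      (f := f) hf.continuousOn hδ
  filter_upwards [Metric.tendsto_nhds.mp (hpg x) (ε / 2) (by positivity)] with i hi
  rw [dist_eq_norm] at hi ⊢
  have e : cfc f (N i) x - cfc f M x
      = (cfc f (N i) - cfc g (N i)) x - (cfc f M - cfc g M) x
        + (cfc g (N i) x - cfc g M x) := by
    simp only [sub_apply]; abel
  rw [e]
  have h1 := ContinuousLinearMap.le_of_opNorm_le _
    (norm_cfc_sub_cfc_le (hNs i) hf.continuousOn hg hδ.le hfg) x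
  have h2 := ContinuousLinearMap.le_of_opNorm_le _
    (norm_cfc_sub_cfc_le hMs hf.continuousOn hg hδ.le hfg) x
  have h3 := norm_add_le ((cfc f (N i) - cfc g (N i)) x
    - (cfc f M - cfc g M) x) (cfc g (N i) x - cfc g M x)
  have h4 := norm_sub_le ((cfc f (N i) - cfc g (N i)) x)
    ((cfc f M - cfc g M) x)
  linarith

/-- Uniform boundedness. It holds for sequences, not for general nets, hence the reductions to
sequences below. -/
theorem TendstoSOT.exists_norm_le {T : ℕ → H →L[ℂ] H} {T' : H →L[ℂ] H}
    (h : TendstoSOT T atTop T') : ∃ r, ∀ n, ‖T n‖ ≤ r :=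
  banach_steinhaus fun x => by
    obtain ⟨C, hC⟩ := (h x).norm.bddAbove_range
    exact ⟨C, fun i => hC ⟨i, rfl⟩⟩

end SOT

/-! ### Functional calculus of commuting pairs -/

section JointCalculus

variable {H : Type u} [NormedAddCommGroup H] [InnerProductSpace ℂ H] [CompleteSpace H]
variable {K : Type u} [NormedAddCommGroup K] [InnerProductSpace ℂ K] [CompleteSpace K]

theorem star_add_I_smul {A B : H →L[ℂ] H} (hA : IsSelfAdjoint A) (hB : IsSelfAdjoint B) :
    star (A + Complex.I • B) = A - Complex.I • B := by
  rw [star_add, star_smul, hA.star_eq, hB.star_eq]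
  simp [sub_eq_add_neg]

theorem isStarNormal_add_I_smul {A B : H →L[ℂ] H} (hA : IsSelfAdjoint A) (hB : IsSelfAdjoint B)
    (h : Commute A B) : IsStarNormal (A + Complex.I • B) := by
  constructor
  rw [star_add_I_smul hA hB]
  have h1 : Commute A (A + Complex.I • B) := (Commute.refl A).add_right (h.smul_right _)
  have h2 : Commute B (A + Complex.I • B) := h.symm.add_right ((Commute.refl B).smul_right _)
  exact h1.sub_left (h2.smul_left _)

theorem continuous_jointCalculus_symbol {φ : ℝ≥0 × ℝ≥0 → ℝ} (hφ : Continuous φ) :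
    Continuous fun z : ℂ => ((φ (z.re.toNNReal, z.im.toNNReal) : ℝ) : ℂ) := by
  have h1 : Continuous fun z : ℂ => z.re.toNNReal :=
    continuous_real_toNNReal.comp Complex.continuous_re
  have h2 : Continuous fun z : ℂ => z.im.toNNReal :=
    continuous_real_toNNReal.comp Complex.continuous_im
  exact Complex.continuous_ofReal.comp (hφ.comp (h1.prodMk h2))

theorem jointCalculus_comp_eq_comp_jointCalculus {φ : ℝ≥0 × ℝ≥0 → ℝ} (hφ : Continuous φ)
    {A B : PosOp H} {A' B' : PosOp K} (h : Commute A.1 B.1) (h' : Commute A'.1 B'.1)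
    {W : K →L[ℂ] H} (hA : A.1 ∘L W = W ∘L A'.1) (hB : B.1 ∘L W = W ∘L B'.1) :
    jointCalculus φ A B ∘L W = W ∘L jointCalculus φ A' B' := by
  have := isStarNormal_add_I_smul A.2.isSelfAdjoint B.2.isSelfAdjoint h
  have := isStarNormal_add_I_smul A'.2.isSelfAdjoint B'.2.isSelfAdjoint h'
  refine cfc_comp_eq_comp_cfc ?_ ?_ (continuous_jointCalculus_symbol hφ)
  · simp [ContinuousLinearMap.add_comp, ContinuousLinearMap.comp_add, hA, hB]
  · rw [star_add_I_smul A.2.isSelfAdjoint B.2.isSelfAdjoint,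
      star_add_I_smul A'.2.isSelfAdjoint B'.2.isSelfAdjoint]
    simp [ContinuousLinearMap.sub_comp, ContinuousLinearMap.comp_sub, hA, hB]

theorem tendstoSOT_jointCalculus {φ : ℝ≥0 × ℝ≥0 → ℝ} (hφ : Continuous φ) {ι : Type*}
    {l : Filter ι} {An Bn : ι → PosOp H} {A B : PosOp H} (hn : ∀ i, Commute (An i).1 (Bn i).1)
    (h : Commute A.1 B.1) {r : ℝ} (hAr : ∀ i, ‖(An i).1‖ ≤ r) (hBr : ∀ i, ‖(Bn i).1‖ ≤ r)
    (hA : TendstoSOT (fun i => (An i).1) l A.1) (hB : TendstoSOT (fun i => (Bn i).1) l B.1) :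
    TendstoSOT (fun i => jointCalculus φ (An i) (Bn i)) l (jointCalculus φ A B) := by
  refine tendstoSOT_cfc (r := max (r + r) ‖A.1 + Complex.I • B.1‖)
    (fun i => isStarNormal_add_I_smul (An i).2.isSelfAdjoint (Bn i).2.isSelfAdjoint (hn i))
    (isStarNormal_add_I_smul A.2.isSelfAdjoint B.2.isSelfAdjoint h) (fun i => ?_)
    (le_max_right _ _) (hA.add (hB.const_smul _)) ?_ (continuous_jointCalculus_symbol hφ)
  · refine le_max_of_le_left ((norm_add_le _ _).trans (add_le_add (hAr i) ?_))
    rw [norm_smul]; simpa using hBr i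
  · simp only [star_add_I_smul A.2.isSelfAdjoint B.2.isSelfAdjoint,
      fun i => star_add_I_smul (An i).2.isSelfAdjoint (Bn i).2.isSelfAdjoint]
    exact hA.sub (hB.const_smul _)

theorem jointCalculus_scalar (φ : ℝ≥0 × ℝ≥0 → ℝ) {A B : PosOp H} {x y : ℝ≥0}
    (hA : A.1 = ((x : ℝ) : ℂ) • 1) (hB : B.1 = ((y : ℝ) : ℂ) • 1) :
    jointCalculus φ A B = ((φ (x, y) : ℝ) : ℂ) • 1 := by
  have e : A.1 + Complex.I • B.1
      = algebraMap ℂ (H →L[ℂ] H) (((x : ℝ) : ℂ) + Complex.I * ((y : ℝ) : ℂ)) := by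
    rw [hA, hB, Algebra.algebraMap_eq_smul_one, add_smul, smul_smul]
  rw [jointCalculus, e, cfc_algebraMap, Algebra.algebraMap_eq_smul_one]
  simp

end JointCalculus

/-! ### Square roots of positive operators -/

section SquareRoot

variable {H K : Type*} [NormedAddCommGroup H] [InnerProductSpace ℂ H] [CompleteSpace H]
  [NormedAddCommGroup K] [InnerProductSpace ℂ K] [CompleteSpace K]

/-- The square root of a positive operator. -/
noncomputable def opSqrt (T : H →L[ℂ] H) : H →L[ℂ] H := CFC.sqrt T

/-- This form brings the square root within reach of `cfc_comp_eq_comp_cfc` and `tendstoSOT_cfc`. -/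
theorem sqrt_eq_complex_cfc {T : H →L[ℂ] H} (hT : T.IsPositive) :
    opSqrt T = cfc (fun z : ℂ => ((Real.sqrt z.re : ℝ) : ℂ)) T := by
  have h0 : 0 ≤ T := (ContinuousLinearMap.nonneg_iff_isPositive T).mpr hT
  rw [opSqrt, CFC.sqrt_eq_real_sqrt T h0, cfcₙ_eq_cfc, cfc_real_eq_complex _ hT.isSelfAdjoint]

theorem continuous_sqrt_re : Continuous fun z : ℂ => ((Real.sqrt z.re : ℝ) : ℂ) := by
  fun_prop

theorem sqrt_comp_eq_comp_sqrt {T : H →L[ℂ] H} {T' : K →L[ℂ] K} (hT : T.IsPositive)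
    (hT' : T'.IsPositive) {W : K →L[ℂ] H} (h : T ∘L W = W ∘L T') :
    opSqrt T ∘L W = W ∘L opSqrt T' := by
  have := hT.isSelfAdjoint.isStarNormal
  have := hT'.isSelfAdjoint.isStarNormal
  rw [sqrt_eq_complex_cfc hT, sqrt_eq_complex_cfc hT']
  refine cfc_comp_eq_comp_cfc h ?_ continuous_sqrt_re
  rwa [hT.isSelfAdjoint.star_eq, hT'.isSelfAdjoint.star_eq]

theorem isSelfAdjoint_sqrt (T : H →L[ℂ] H) : IsSelfAdjoint (opSqrt T) :=
  (CFC.sqrt_nonneg T).isSelfAdjoint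

theorem sqrt_mul_sqrt {T : H →L[ℂ] H} (hT : T.IsPositive) : opSqrt T * opSqrt T = T :=
  CFC.sqrt_mul_sqrt_self T ((ContinuousLinearMap.nonneg_iff_isPositive T).mpr hT)

theorem norm_sqrt_apply_sq {T : H →L[ℂ] H} (hT : T.IsPositive) (x : H) :
    ‖opSqrt T x‖ ^ 2 = T.reApplyInnerSelf x := by
  rw [ContinuousLinearMap.reApplyInnerSelf_apply, ← sqrt_mul_sqrt hT,
    mul_apply_eq_comp, sqrt_mul_sqrt hT, ← inner_self_eq_norm_sq (𝕜 := ℂ)]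
  have h := (isSelfAdjoint_sqrt T).isSymmetric (opSqrt T x) x
  simp only [ContinuousLinearMap.coe_coe] at h
  rw [h]

end SquareRoot

theorem tendstoSOT_sqrt {H : Type u} [NormedAddCommGroup H] [InnerProductSpace ℂ H]
    [CompleteSpace H] {ι : Type*} {l : Filter ι} {T : ι → H →L[ℂ] H} {T' : H →L[ℂ] H}
    (hT : ∀ i, (T i).IsPositive) (hT' : T'.IsPositive) {r : ℝ} (hr : ∀ i, ‖T i‖ ≤ r)
    (h : TendstoSOT T l T') : TendstoSOT (fun i => opSqrt (T i)) l (opSqrt T') := by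
  simp only [sqrt_eq_complex_cfc hT', fun i => sqrt_eq_complex_cfc (hT i)]
  refine tendstoSOT_cfc (r := max r ‖T'‖) (fun i => (hT i).isSelfAdjoint.isStarNormal)
    hT'.isSelfAdjoint.isStarNormal (fun i => le_max_of_le_left (hr i)) (le_max_right _ _) h ?_
    continuous_sqrt_re
  simpa only [hT'.isSelfAdjoint.star_eq, fun i => (hT i).isSelfAdjoint.star_eq] using h

/-! ### Range projections and Douglas' lemma -/

section RangeProjection

variable {H K : Type*} [NormedAddCommGroup H] [InnerProductSpace ℂ H] [CompleteSpace H]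
  [NormedAddCommGroup K] [InnerProductSpace ℂ K]

/-- The orthogonal projection onto the closure of the range of `D`. -/
noncomputable def rangeProjection (D : H →L[ℂ] H) : H →L[ℂ] H :=
  (LinearMap.range D.toLinearMap).topologicalClosure.starProjection

theorem isSelfAdjoint_rangeProjection (D : H →L[ℂ] H) : IsSelfAdjoint (rangeProjection D) :=
  isSelfAdjoint_starProjection _

theorem rangeProjection_mul_self (D : H →L[ℂ] H) : rangeProjection D * D = D := by
  ext x
  exact Submodule.starProjection_eq_self_iff.mpr
    (Submodule.le_topologicalClosure _ (LinearMap.mem_range_self _ x))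

theorem rangeProjection_mem (D : H →L[ℂ] H) (x : H) :
    rangeProjection D x ∈ closure (Set.range D) :=
  Submodule.starProjection_apply_mem (LinearMap.range D.toLinearMap).topologicalClosure x

/-- A cancellation rule: by continuity, operators agreeing on the range of D agree on its closure.
-/
theorem comp_rangeProjection_eq {X Y : H →L[ℂ] K} {D : H →L[ℂ] H} (h : X ∘L D = Y ∘L D) :
    X ∘L rangeProjection D = Y ∘L rangeProjection D := by
  ext x
  have hc : IsClosed {y | X y = Y y} := isClosed_eq X.continuous Y.continuous
  refine closure_minimal ?_ hc (rangeProjection_mem D x)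
  rintro _ ⟨z, rfl⟩
  exact congrArg (fun Z : H →L[ℂ] K => Z z) h

variable [CompleteSpace K]

theorem rangeProjection_mul_rangeProjection (D : H →L[ℂ] H) :
    rangeProjection D * rangeProjection D = rangeProjection D := by
  have := comp_rangeProjection_eq (X := rangeProjection D) (Y := 1) (D := D)
    (rangeProjection_mul_self D)
  exact this

theorem self_mul_rangeProjection {D : H →L[ℂ] H} (hD : IsSelfAdjoint D) :
    D * rangeProjection D = D := by
  have := congrArg star (rangeProjection_mul_self D)
  rwa [star_mul, hD.star_eq, (isSelfAdjoint_rangeProjection D).star_eq] at this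

theorem rangeProjection_comp_comp_rangeProjection {D : H →L[ℂ] H} {D' : K →L[ℂ] K}
    {W : K →L[ℂ] H} (h : D ∘L W = W ∘L D') :
    rangeProjection D ∘L W ∘L rangeProjection D' = W ∘L rangeProjection D' := by
  rw [← ContinuousLinearMap.comp_assoc]
  refine comp_rangeProjection_eq ?_
  rw [ContinuousLinearMap.comp_assoc, ← h, ← ContinuousLinearMap.comp_assoc]
  exact congrArg (· ∘L W) (rangeProjection_mul_self D)

/-- An operator intertwining two self-adjoint operators intertwines their range projections. -/
theorem rangeProjection_comp_eq {D : H →L[ℂ] H} {D' : K →L[ℂ] K} (hD : IsSelfAdjoint D)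
    (hD' : IsSelfAdjoint D') {W : K →L[ℂ] H} (h : D ∘L W = W ∘L D') :
    rangeProjection D ∘L W = W ∘L rangeProjection D' := by
  have h2 : D' ∘L ContinuousLinearMap.adjoint W = ContinuousLinearMap.adjoint W ∘L D := by
    have := congrArg ContinuousLinearMap.adjoint h
    rw [ContinuousLinearMap.adjoint_comp, ContinuousLinearMap.adjoint_comp, hD.adjoint_eq,
      hD'.adjoint_eq] at this
    exact this.symm
  -- The one-sided identity for W*, after taking adjoints, is PWP' = PW; for W itself it is PWP' =
  -- WP'.
  have h3 := congrArg ContinuousLinearMap.adjoint (rangeProjection_comp_comp_rangeProjection h2)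
  simp only [ContinuousLinearMap.adjoint_comp, ContinuousLinearMap.adjoint_adjoint,
    (isSelfAdjoint_rangeProjection _).adjoint_eq] at h3
  rw [← h3, ContinuousLinearMap.comp_assoc, rangeProjection_comp_comp_rangeProjection h]

/-- Cancel on the right, then on the left through adjoints. For D = D' this shows that an operator Q
with PQP = Q is determined by DQD. -/
theorem rangeProjection_comp_comp_eq {D : H →L[ℂ] H} {D' : K →L[ℂ] K} (hD : IsSelfAdjoint D)
    {X Y : K →L[ℂ] H} (h : D ∘L X ∘L D' = D ∘L Y ∘L D') :
    rangeProjection D ∘L X ∘L rangeProjection D' =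
      rangeProjection D ∘L Y ∘L rangeProjection D' := by
  have h1 : (D ∘L X) ∘L rangeProjection D' = (D ∘L Y) ∘L rangeProjection D' :=
    comp_rangeProjection_eq h
  have h2 := congrArg ContinuousLinearMap.adjoint h1
  simp only [ContinuousLinearMap.adjoint_comp, ← ContinuousLinearMap.comp_assoc,
    hD.adjoint_eq] at h2
  have h3 := congrArg ContinuousLinearMap.adjoint (comp_rangeProjection_eq h2)
  simpa only [ContinuousLinearMap.adjoint_comp, ContinuousLinearMap.adjoint_adjoint,
    (isSelfAdjoint_rangeProjection _).adjoint_eq] using h3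

/-- Douglas' lemma: an operator dominated by `D` factors through `D`. -/
theorem exists_mul_eq_of_norm_le {Y D : H →L[ℂ] H} (h : ∀ x, ‖Y x‖ ≤ ‖D x‖) :
    ∃ X : H →L[ℂ] H, X * D = Y ∧ X * rangeProjection D = X := by
  let M := (LinearMap.range D.toLinearMap).topologicalClosure
  let e : H →ₗ[ℂ] M := D.toLinearMap.codRestrict M
    fun x => Submodule.le_topologicalClosure _ (LinearMap.mem_range_self _ x)
  have he : DenseRange e := by
    intro y
    rw [closure_subtype]
    have : ((↑) '' Set.range e : Set H) = Set.range D := by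
      rw [← Set.range_comp]; rfl
    rw [this]
    exact y.2
  have hb : ∃ C, ∀ x, ‖Y.toLinearMap x‖ ≤ C * ‖e x‖ := ⟨1, fun x => by simpa [e] using h x⟩
  -- The norm bound makes Dx ↦ Yx well defined and contractive on the range of D. X is its extension
  -- to the closure, and zero on the orthogonal complement.
  refine ⟨Y.toLinearMap.extendOfNorm e ∘L M.orthogonalProjectionOnto, ?_, ?_⟩
  · ext x
    have : M.orthogonalProjectionOnto (D x) = e x :=
      Submodule.orthogonalProjectionOnto_mem_subspace_eq_self (e x)
    simp [this, LinearMap.extendOfNorm_eq he hb]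
  · ext x
    have : M.orthogonalProjectionOnto (M.starProjection x) = M.orthogonalProjectionOnto x := by
      rw [Submodule.starProjection_apply]
      exact Submodule.orthogonalProjectionOnto_mem_subspace_eq_self _
    simp [rangeProjection, M, this]

end RangeProjection

/-! ### Factorization of a pair through a commuting pair -/

section Factorization

variable {H : Type u} [NormedAddCommGroup H] [InnerProductSpace ℂ H] [CompleteSpace H]
variable {K : Type u} [NormedAddCommGroup K] [InnerProductSpace ℂ K] [CompleteSpace K]

theorem PosOp.conj_val_of_isSelfAdjoint (A : PosOp H) {C : H →L[ℂ] H} (hC : IsSelfAdjoint C) :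
    (A.conj C).1 = C * A.1 * C := by
  simp only [PosOp.conj, hC.adjoint_eq]
  rfl

/-- `(A, B)` is obtained from the commuting pair `(R, S)` by conjugation with `D = (A + B)^{1/2}`,
and `R + S` is the range projection of `D`. -/
structure IsFactorization (A B R S : PosOp H) : Prop where
  left : opSqrt (A.1 + B.1) * R.1 * opSqrt (A.1 + B.1) = A.1
  right : opSqrt (A.1 + B.1) * S.1 * opSqrt (A.1 + B.1) = B.1
  left_mul : R.1 * rangeProjection (opSqrt (A.1 + B.1)) = R.1
  right_mul : S.1 * rangeProjection (opSqrt (A.1 + B.1)) = S.1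
  add_eq : R.1 + S.1 = rangeProjection (opSqrt (A.1 + B.1))

namespace IsFactorization

variable {A B R S : PosOp H} {A' B' R' S' : PosOp K}

theorem mul_left (h : IsFactorization A B R S) :
    rangeProjection (opSqrt (A.1 + B.1)) * R.1 = R.1 := by
  have := congrArg star h.left_mul
  rwa [star_mul, R.2.isSelfAdjoint.star_eq, (isSelfAdjoint_rangeProjection _).star_eq] at this

theorem mul_right (h : IsFactorization A B R S) :
    rangeProjection (opSqrt (A.1 + B.1)) * S.1 = S.1 := by
  have := congrArg star h.right_mul
  rwa [star_mul, S.2.isSelfAdjoint.star_eq, (isSelfAdjoint_rangeProjection _).star_eq] at this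

theorem commute (h : IsFactorization A B R S) : Commute R.1 S.1 := by
  have e : S.1 = rangeProjection (opSqrt (A.1 + B.1)) - R.1 := by rw [← h.add_eq]; abel
  rw [e]
  refine Commute.sub_right ?_ (Commute.refl _)
  rw [Commute, SemiconjBy, h.left_mul, h.mul_left]

theorem conj_left (h : IsFactorization A B R S) : R.conj (opSqrt (A.1 + B.1)) = A :=
  Subtype.ext (by rw [PosOp.conj_val_of_isSelfAdjoint _ (isSelfAdjoint_sqrt _), h.left])

theorem conj_right (h : IsFactorization A B R S) : S.conj (opSqrt (A.1 + B.1)) = B :=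
  Subtype.ext (by rw [PosOp.conj_val_of_isSelfAdjoint _ (isSelfAdjoint_sqrt _), h.right])

end IsFactorization

theorem isPositive_sum (A B : PosOp H) : (A.1 + B.1).IsPositive := A.2.add B.2

theorem norm_sqrt_add_apply_sq (A B : PosOp H) (x : H) :
    ‖opSqrt (A.1 + B.1) x‖ ^ 2 = ‖opSqrt A.1 x‖ ^ 2 + ‖opSqrt B.1 x‖ ^ 2 := by
  rw [norm_sqrt_apply_sq (isPositive_sum A B), norm_sqrt_apply_sq A.2, norm_sqrt_apply_sq B.2]
  simp [ContinuousLinearMap.reApplyInnerSelf_apply, inner_add_left]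

/-- Douglas' lemma writes Z^{1/2} = XD, and R = X*X works. -/
theorem exists_posOp_mul_mul_eq (Z : PosOp H) {D : H →L[ℂ] H} (hD : IsSelfAdjoint D)
    (hZ : ∀ x, ‖opSqrt Z.1 x‖ ≤ ‖D x‖) :
    ∃ R : PosOp H, D * R.1 * D = Z.1 ∧ R.1 * rangeProjection D = R.1 ∧
      rangeProjection D * R.1 = R.1 := by
  obtain ⟨X, hXD, hXP⟩ := exists_mul_eq_of_norm_le hZ
  refine ⟨⟨ContinuousLinearMap.adjoint X ∘L X,
    ContinuousLinearMap.isPositive_adjoint_comp_self X⟩, ?_, ?_, ?_⟩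
  · have : D * (star X * X) * D = star (X * D) * (X * D) := by
      rw [star_mul, hD.star_eq]; simp only [mul_assoc]
    refine this.trans ?_
    rw [hXD, (isSelfAdjoint_sqrt _).star_eq, sqrt_mul_sqrt Z.2]
  · change star X * X * _ = star X * X
    rw [mul_assoc, hXP]
  · change _ * (star X * X) = star X * X
    have := congrArg star hXP
    rw [star_mul, (isSelfAdjoint_rangeProjection _).star_eq] at this
    rw [← mul_assoc, this]

theorem add_eq_rangeProjection {A B R S D : H →L[ℂ] H} (hD : IsSelfAdjoint D)
    (hDD : D * D = A + B) (hR : D * R * D = A) (hS : D * S * D = B)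
    (hRP : R * rangeProjection D = R) (hPR : rangeProjection D * R = R)
    (hSP : S * rangeProjection D = S) (hPS : rangeProjection D * S = S) :
    R + S = rangeProjection D := by
  have h1 : D ∘L (R + S) ∘L D = D ∘L 1 ∘L D := by
    change D * ((R + S) * D) = D * D
    rw [← mul_assoc, mul_add, add_mul, hR, hS, hDD]
  have h2 := rangeProjection_comp_comp_eq hD h1
  change rangeProjection D * ((R + S) * rangeProjection D)
    = rangeProjection D * (1 * rangeProjection D) at h2
  rwa [one_mul, rangeProjection_mul_rangeProjection, add_mul, hRP, hSP, mul_add, hPR, hPS] at h2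

theorem norm_sqrt_apply_le (A B : PosOp H) (x : H) :
    ‖opSqrt A.1 x‖ ≤ ‖opSqrt (A.1 + B.1) x‖ := by
  have h := norm_sqrt_add_apply_sq A B x
  have h' := sq_nonneg ‖opSqrt B.1 x‖
  exact (sq_le_sq₀ (norm_nonneg _) (norm_nonneg _)).mp (by linarith)

theorem exists_isFactorization (A B : PosOp H) : ∃ R S, IsFactorization A B R S := by
  have hD := isSelfAdjoint_sqrt (A.1 + B.1)
  have hB : ∀ x, ‖opSqrt B.1 x‖ ≤ ‖opSqrt (A.1 + B.1) x‖ := fun x => by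
    rw [add_comm A.1 B.1]; exact norm_sqrt_apply_le B A x
  obtain ⟨R, hR, hRP, hPR⟩ := exists_posOp_mul_mul_eq A hD (norm_sqrt_apply_le A B)
  obtain ⟨S, hS, hSP, hPS⟩ := exists_posOp_mul_mul_eq B hD hB
  exact ⟨R, S, hR, hS, hRP, hSP, add_eq_rangeProjection hD (sqrt_mul_sqrt (isPositive_sum A B))
    hR hS hRP hPR hSP hPS⟩

/-- R and S are determined by DRD, DSD and their support in P, so an intertwiner of the pairs has no
choice but to intertwine them. Both sides are compared after multiplication by D and D', which then
cancel to P and P'. -/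
theorem IsFactorization.comp_eq_comp {A B R S : PosOp H} {A' B' R' S' : PosOp K}
    (h : IsFactorization A B R S) (h' : IsFactorization A' B' R' S') {W : K →L[ℂ] H}
    (hA : A.1 ∘L W = W ∘L A'.1) (hB : B.1 ∘L W = W ∘L B'.1) :
    opSqrt (A.1 + B.1) ∘L W = W ∘L opSqrt (A'.1 + B'.1) ∧
      R.1 ∘L W = W ∘L R'.1 ∧ S.1 ∘L W = W ∘L S'.1 := by
  set D := opSqrt (A.1 + B.1)
  set D' := opSqrt (A'.1 + B'.1)
  have hD : IsSelfAdjoint D := isSelfAdjoint_sqrt _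
  have hD' : IsSelfAdjoint D' := isSelfAdjoint_sqrt _
  have hDW : D ∘L W = W ∘L D' := by
    refine sqrt_comp_eq_comp_sqrt (isPositive_sum A B) (isPositive_sum A' B') ?_
    rw [ContinuousLinearMap.add_comp, ContinuousLinearMap.comp_add, hA, hB]
  have hPW := rangeProjection_comp_eq hD hD' hDW
  have key : ∀ {Z Q : H →L[ℂ] H} {Z' Q' : K →L[ℂ] K}, D * Q * D = Z → D' * Q' * D' = Z' →
      Z ∘L W = W ∘L Z' → rangeProjection D * Q = Q → Q * rangeProjection D = Q →
      rangeProjection D' * Q' = Q' → Q' * rangeProjection D' = Q' → Q ∘L W = W ∘L Q' := by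
    intro Z Q Z' Q' h1 h2 h3 h4 h5 h6 h7
    have e : D ∘L (Q ∘L W) ∘L D' = D ∘L (W ∘L Q') ∘L D' := by
      calc D ∘L (Q ∘L W) ∘L D' = (D * Q) ∘L (W ∘L D') := rfl
        _ = (D * Q * D) ∘L W := by rw [← hDW]; rfl
        _ = W ∘L (D' * Q' * D') := by rw [h1, h2, h3]
        _ = (W ∘L D') ∘L (Q' * D') := rfl
        _ = D ∘L (W ∘L Q') ∘L D' := by rw [← hDW]; rfl
    have e2 := rangeProjection_comp_comp_eq hD e
    calc Q ∘L W = (rangeProjection D * (Q * rangeProjection D)) ∘L W := by rw [h5, h4]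
      _ = (rangeProjection D * Q) ∘L (rangeProjection D ∘L W) := rfl
      _ = rangeProjection D ∘L (Q ∘L W) ∘L rangeProjection D' := by rw [hPW]; rfl
      _ = (rangeProjection D ∘L W) ∘L (Q' * rangeProjection D') := by rw [e2]; rfl
      _ = W ∘L (rangeProjection D' * (Q' * rangeProjection D')) := by rw [hPW]; rfl
      _ = W ∘L Q' := by rw [h7, h6]
  exact ⟨hDW, key h.left h'.left hA h.mul_left h.left_mul h'.mul_left h'.left_mul,
    key h.right h'.right hB h.mul_right h.right_mul h'.mul_right h'.right_mul⟩

end Factorization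

/-! ### The explicit formula and naturality of a PW-calculus -/

section Calculus

variable {H : Type u} [NormedAddCommGroup H] [InnerProductSpace ℂ H] [CompleteSpace H]
variable {K : Type u} [NormedAddCommGroup K] [InnerProductSpace ℂ K] [CompleteSpace K]
variable {φ : ℝ≥0 × ℝ≥0 → ℝ} {Φ : Operation.{u}}

theorem IsPWCalculus.apply_conj (hΦ : IsPWCalculus φ Φ) {R S : PosOp H} (hRS : Commute R.1 S.1)
    {D : H →L[ℂ] H} (hD : IsSelfAdjoint D)
    (hr : closure (Set.range (R.1 + S.1)) ⊆ closure (Set.range D)) :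
    (Φ H (R.conj D) (S.conj D)).1 = D * jointCalculus φ R S * D := by
  rw [hΦ.homogeneous H H R S D hr, hΦ.extends_usual H R S hRS, hD.adjoint_eq]
  rfl

/-- Homogeneity applies with C = D because R + S = P has its range in the closure of the range of D.
-/
theorem IsPWCalculus.apply_eq (hΦ : IsPWCalculus φ Φ) {A B R S : PosOp H}
    (h : IsFactorization A B R S) :
    (Φ H A B).1 = opSqrt (A.1 + B.1) * jointCalculus φ R S * opSqrt (A.1 + B.1) := by
  rw [← hΦ.apply_conj h.commute (isSelfAdjoint_sqrt _) ?_, h.conj_left, h.conj_right]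
  rw [h.add_eq]
  refine closure_minimal ?_ isClosed_closure
  rintro _ ⟨x, rfl⟩
  exact rangeProjection_mem _ x

/-- Naturality of the PW-functional calculus. -/
theorem IsPWCalculus.comp_eq_comp (hφ : Continuous φ) (hΦ : IsPWCalculus φ Φ) {A B : PosOp H}
    {A' B' : PosOp K} {W : K →L[ℂ] H} (hA : A.1 ∘L W = W ∘L A'.1) (hB : B.1 ∘L W = W ∘L B'.1) :
    (Φ H A B).1 ∘L W = W ∘L (Φ K A' B').1 := by
  obtain ⟨R, S, h⟩ := exists_isFactorization A B
  obtain ⟨R', S', h'⟩ := exists_isFactorization A' B'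
  obtain ⟨hD, hR, hS⟩ := h.comp_eq_comp h' hA hB
  have hJ := jointCalculus_comp_eq_comp_jointCalculus hφ h.commute h'.commute hR hS
  rw [hΦ.apply_eq h, hΦ.apply_eq h']
  generalize opSqrt (A.1 + B.1) = D at *
  generalize opSqrt (A'.1 + B'.1) = D' at *
  calc (D * jointCalculus φ R S * D) ∘L W = (D * jointCalculus φ R S) ∘L (D ∘L W) := rfl
    _ = D ∘L (jointCalculus φ R S ∘L W) ∘L D' := by rw [hD]; rfl
    _ = (D ∘L W) ∘L (jointCalculus φ R' S' * D') := by rw [hJ]; rfl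
    _ = W ∘L (D' * jointCalculus φ R' S' * D') := by rw [hD]; rfl

theorem IsPWCalculus.respectsDirectSums (hφ : Continuous φ) (hΦ : IsPWCalculus φ Φ) :
    RespectsDirectSums Φ := by
  intro H _ _ _ ι G _ _ _ V _ A B A' B' hA hB i x
  have := hΦ.comp_eq_comp hφ (A := A) (B := B) (A' := A' i) (B' := B' i)
    (W := (V i).toContinuousLinearMap) (by ext x; exact hA i x) (by ext x; exact hB i x)
  exact congrArg (fun Z : G i →L[ℂ] H => Z x) this

end Calculus

/-! ### Strong limits, order and inverses -/

section Sequences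

variable {H : Type u} [NormedAddCommGroup H] [InnerProductSpace ℂ H]

theorem TendstoSOT.of_inverse {ι : Type*} {l : Filter ι} {S T : ι → H →L[ℂ] H}
    {S' T' : H →L[ℂ] H} (hT : TendstoSOT T l T') {r : ℝ} (hr : ∀ i, ‖S i‖ ≤ r)
    (h : ∀ i, S i * T i = 1) (h' : T' * S' = 1) : TendstoSOT S l S' := by
  -- The resolvent identity.
  have e : ∀ i, S i = S' + S i * ((T' - T i) * S') := fun i => by
    rw [sub_mul, h', mul_sub, mul_one, ← mul_assoc, h, one_mul]; abel
  intro x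
  have h0 : Tendsto (fun i => S i (T' (S' x) - T i (S' x))) l (𝓝 0) := by
    refine squeeze_zero_norm (a := fun i => r * ‖T' (S' x) - T i (S' x)‖)
      (fun i => (S i).le_of_opNorm_le (hr i) _) ?_
    simpa using ((hT (S' x)).const_sub (T' (S' x))).norm.const_mul r
  have h1 := h0.const_add (S' x)
  rw [add_zero] at h1
  refine h1.congr fun i => ?_
  conv_rhs => rw [e i]
  simp

theorem tendsto_self_of_mem_closure {ι : Type*} {l : Filter ι} {T : ι → H →L[ℂ] H}
    (hT : ∀ i, ‖T i‖ ≤ 1) {s : Set H} (h : ∀ y ∈ s, Tendsto (fun i => T i y) l (𝓝 y)) {y : H}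
    (hy : y ∈ closure s) : Tendsto (fun i => T i y) l (𝓝 y) := by
  rw [Metric.tendsto_nhds]
  intro ε hε
  obtain ⟨z, hz, hyz⟩ := Metric.mem_closure_iff.mp hy (ε / 3) (by positivity)
  filter_upwards [Metric.tendsto_nhds.mp (h z hz) (ε / 3) (by positivity)] with i hi
  have h1 : dist (T i y) (T i z) ≤ dist y z := by
    rw [dist_eq_norm, dist_eq_norm, ← map_sub]
    simpa using (T i).le_of_opNorm_le (hT i) (y - z)
  have h2 := dist_triangle4 (T i y) (T i z) z y
  rw [dist_comm z y] at h2
  linarith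

theorem commute_of_add_eq_one {R S : H →L[ℂ] H} (h : R + S = 1) : Commute R S := by
  rw [← eq_sub_iff_add_eq'] at h
  rw [h]
  exact (Commute.one_right R).sub_right (Commute.refl R)

theorem le_reApplyInnerSelf {T : H →L[ℂ] H} {ε : ℝ} (h : (ε : ℂ) • (1 : H →L[ℂ] H) ≤ T) (x : H) :
    ε * ‖x‖ ^ 2 ≤ T.reApplyInnerSelf x := by
  have h1 := h.re_inner_nonneg_left x
  have h2 : RCLike.re (inner ℂ ((T - (ε : ℂ) • (1 : H →L[ℂ] H)) x) x)
      = T.reApplyInnerSelf x - ε * ‖x‖ ^ 2 := by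
    rw [sub_apply, inner_sub_left, map_sub, ContinuousLinearMap.reApplyInnerSelf_apply]
    congr 1
    rw [smul_apply, inner_smul_left, one_apply_eq_self, inner_self_eq_norm_sq_to_K]
    simp [← Complex.ofReal_pow]
  linarith

theorem le_of_tendstoSOT {T : ℕ → H →L[ℂ] H} {T' : H →L[ℂ] H} (h : TendstoSOT T atTop T')
    {S : H →L[ℂ] H} (hS : ∀ n, S ≤ T n) : S ≤ T' := by
  rw [ContinuousLinearMap.le_def, ContinuousLinearMap.isPositive_iff_complex]
  intro x
  have hlim : Tendsto (fun n => inner ℂ ((T n - S) x) x) atTop (𝓝 (inner ℂ ((T' - S) x) x)) :=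
    ((h x).sub_const (S x)).inner tendsto_const_nhds
  have hn := fun n => (ContinuousLinearMap.isPositive_iff_complex _).mp (hS n) x
  constructor
  · refine tendsto_nhds_unique ?_ hlim
    have := (Complex.continuous_ofReal.comp Complex.continuous_re).continuousAt.tendsto.comp hlim
    exact this.congr fun n => (hn n).1
  · exact ge_of_tendsto' ((Complex.continuous_re.continuousAt.tendsto.comp hlim))
      fun n => (hn n).2

variable [CompleteSpace H]

theorem TendstoSOT.mul_of_seq {S T : ℕ → H →L[ℂ] H} {S' T' : H →L[ℂ] H}
    (hS : TendstoSOT S atTop S') (hT : TendstoSOT T atTop T') :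
    TendstoSOT (fun n => S n * T n) atTop (S' * T') :=
  hS.mul hT hS.exists_norm_le.choose_spec

theorem PosOp.norm_le_one_of_add_eq_one {R S : PosOp H} (h : R.1 + S.1 = 1) : ‖R.1‖ ≤ 1 := by
  have h0 : 0 ≤ R.1 := (ContinuousLinearMap.nonneg_iff_isPositive _).mpr R.2
  have h1 : R.1 ≤ 1 := by
    rw [ContinuousLinearMap.le_def, ← h, add_sub_cancel_left]; exact S.2
  exact (CStarAlgebra.norm_le_norm_of_nonneg_of_le h0 h1).trans ContinuousLinearMap.norm_id_le

/-- T is coercive, hence invertible, and so is its square root. The bound comes from ε‖Cx‖² ≤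
‖T^{1/2}Cx‖² = ‖x‖²; it depends on ε only, so it is uniform along a sequence bounded below by ε. -/
theorem exists_inverse_sqrt {T : H →L[ℂ] H} (hT : T.IsPositive) {ε : ℝ} (hε : 0 < ε)
    (h : (ε : ℂ) • (1 : H →L[ℂ] H) ≤ T) :
    ∃ C : H →L[ℂ] H, IsSelfAdjoint C ∧ opSqrt T * C = 1 ∧ C * opSqrt T = 1 ∧
      ‖C‖ ≤ (Real.sqrt ε)⁻¹ := by
  have hle := le_reApplyInnerSelf h
  have hu : IsUnit T := by
    refine ContinuousLinearMap.isUnit_of_forall_le_norm_inner_map T (c := ⟨ε, hε.le⟩)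
      (by exact_mod_cast hε) fun x => ?_
    have h1 := hle x
    have h2 := RCLike.re_le_norm (inner ℂ (T x) x)
    rw [ContinuousLinearMap.reApplyInnerSelf_apply] at h1
    change ‖x‖ ^ 2 * ε ≤ _
    linarith
  have hu' : IsUnit (opSqrt T) := by
    rw [← sqrt_mul_sqrt hT] at hu
    exact ((Commute.refl (opSqrt T)).isUnit_mul_iff.mp hu).1
  obtain ⟨D, hD⟩ := hu'
  have h1 : opSqrt T * ↑D⁻¹ = 1 := by rw [← hD, Units.mul_inv]
  have h2 : ↑D⁻¹ * opSqrt T = 1 := by rw [← hD, Units.inv_mul]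
  refine ⟨↑D⁻¹, ?_, h1, h2, ?_⟩
  · have h3 := congrArg star h1
    rw [star_mul, (isSelfAdjoint_sqrt T).star_eq, star_one] at h3
    exact left_inv_eq_right_inv h3 h1
  · refine ContinuousLinearMap.opNorm_le_bound _ (by positivity) fun x => ?_
    have h4 := hle ((D⁻¹ : (H →L[ℂ] H)ˣ).1 x)
    rw [← norm_sqrt_apply_sq hT, ← mul_apply_eq_comp, h1, one_apply_eq_self] at h4
    rw [inv_mul_eq_div, le_div_iff₀ (Real.sqrt_pos.mpr hε)]
    refine (sq_le_sq₀ (by positivity) (norm_nonneg _)).mp ?_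
    rw [mul_pow, Real.sq_sqrt hε.le]
    linarith

end Sequences

/-! ### Strong continuity for sums bounded below -/

section Continuity

variable {H : Type u} [NormedAddCommGroup H] [InnerProductSpace ℂ H] [CompleteSpace H]
variable {φ : ℝ≥0 × ℝ≥0 → ℝ} {Φ : Operation.{u}}

theorem PosOp.conj_conj (A : PosOp H) {C D : H →L[ℂ] H} (hC : IsSelfAdjoint C)
    (hD : IsSelfAdjoint D) (h : C * D = 1) : (A.conj C).conj D = A := by
  have h' := congrArg star h
  rw [star_mul, hC.star_eq, hD.star_eq, star_one] at h'
  refine Subtype.ext ?_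
  rw [PosOp.conj_val_of_isSelfAdjoint _ hD, PosOp.conj_val_of_isSelfAdjoint _ hC,
    show D * (C * A.1 * C) * D = (D * C) * A.1 * (C * D) by simp only [mul_assoc], h, h',
    one_mul, mul_one]

theorem conj_add_conj_eq_one {A B : PosOp H} {C : H →L[ℂ] H} (hC : IsSelfAdjoint C)
    (h1 : opSqrt (A.1 + B.1) * C = 1) (h2 : C * opSqrt (A.1 + B.1) = 1) :
    (A.conj C).1 + (B.conj C).1 = 1 := by
  rw [PosOp.conj_val_of_isSelfAdjoint _ hC, PosOp.conj_val_of_isSelfAdjoint _ hC, ← add_mul,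
    ← mul_add]
  nth_rw 1 [← sqrt_mul_sqrt (isPositive_sum A B)]
  rw [← mul_assoc, h2, one_mul, h1]

theorem IsPWCalculus.apply_eq_of_inverse (hΦ : IsPWCalculus φ Φ) {A B : PosOp H} {C : H →L[ℂ] H}
    (hC : IsSelfAdjoint C) (h1 : opSqrt (A.1 + B.1) * C = 1) (h2 : C * opSqrt (A.1 + B.1) = 1) :
    (Φ H A B).1 = opSqrt (A.1 + B.1) * jointCalculus φ (A.conj C) (B.conj C)
      * opSqrt (A.1 + B.1) := by
  have hD := isSelfAdjoint_sqrt (A.1 + B.1)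
  have h3 := hΦ.apply_conj (commute_of_add_eq_one (conj_add_conj_eq_one hC h1 h2)) hD ?_
  · rwa [PosOp.conj_conj A hC hD h2, PosOp.conj_conj B hC hD h2] at h3
  · have : Set.range (opSqrt (A.1 + B.1)) = Set.univ :=
      Set.eq_univ_of_forall fun x => ⟨C x, congrArg (fun Z : H →L[ℂ] H => Z x) h1⟩
    rw [this, closure_univ]
    exact Set.subset_univ _

theorem TendstoSOT.conj {A : ℕ → PosOp H} {A' : PosOp H}
    (hA : TendstoSOT (fun n => (A n).1) atTop A'.1) {C : ℕ → H →L[ℂ] H} {C' : H →L[ℂ] H}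
    (hC : TendstoSOT C atTop C') (hn : ∀ n, IsSelfAdjoint (C n)) (hC' : IsSelfAdjoint C') :
    TendstoSOT (fun n => ((A n).conj (C n)).1) atTop (A'.conj C').1 := by
  simp only [PosOp.conj_val_of_isSelfAdjoint _ hC',
    fun n => PosOp.conj_val_of_isSelfAdjoint (A n) (hn n)]
  exact (hC.mul_of_seq hA).mul_of_seq hC

/-- With C = D⁻¹, every factor of D φ(CAC, CBC) D converges strongly along the sequence. The limit
pair inherits the bound A + B ≥ ε, so it has a C of its own. -/
theorem IsPWCalculus.sotContinuousBoundedBelow (hφ : Continuous φ) (hΦ : IsPWCalculus φ Φ) :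
    SOTContinuousBoundedBelow Φ := by
  intro H _ _ _ A B An Bn ε hε hA hB hle
  have hT := hA.add hB
  obtain ⟨r, hr⟩ := hT.exists_norm_le
  have hD : TendstoSOT (fun n => opSqrt ((An n).1 + (Bn n).1)) atTop (opSqrt (A.1 + B.1)) :=
    tendstoSOT_sqrt (fun n => isPositive_sum (An n) (Bn n)) (isPositive_sum A B) hr hT
  obtain ⟨C, hC, h1, h2, -⟩ := exists_inverse_sqrt (isPositive_sum A B) hε (le_of_tendstoSOT hT hle)
  choose Cn hCn h1n h2n hr' using fun n =>
    exists_inverse_sqrt (isPositive_sum (An n) (Bn n)) hε (hle n)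
  have hCC : TendstoSOT Cn atTop C := hD.of_inverse hr' h2n h1
  have hJ := tendstoSOT_jointCalculus hφ
    (fun n => commute_of_add_eq_one (conj_add_conj_eq_one (hCn n) (h1n n) (h2n n)))
    (commute_of_add_eq_one (conj_add_conj_eq_one hC h1 h2))
    (fun n => PosOp.norm_le_one_of_add_eq_one (conj_add_conj_eq_one (hCn n) (h1n n) (h2n n)))
    (fun n => PosOp.norm_le_one_of_add_eq_one
      ((add_comm _ _).trans (conj_add_conj_eq_one (hCn n) (h1n n) (h2n n))))
    (hA.conj hCC hCn hC) (hB.conj hCC hCn hC)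
  simp only [hΦ.apply_eq_of_inverse hC h1 h2,
    fun n => hΦ.apply_eq_of_inverse (hCn n) (h1n n) (h2n n)]
  exact (hD.mul_of_seq hJ).mul_of_seq hD

end Continuity

/-! ### Factors of the shifted pair -/

section Shift

variable {H : Type u} [NormedAddCommGroup H] [InnerProductSpace ℂ H] [CompleteSpace H]

theorem PosOp.shift_add_shift (A B : PosOp H) (ε : ℝ≥0) :
    (A.shift ε).1 + (B.shift ε).1 = A.1 + B.1 + (2 * ((ε : ℝ) : ℂ)) • 1 := by
  simp only [PosOp.shift, two_mul, add_smul]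
  abel

theorem PosOp.le_shift_add_shift (A B : PosOp H) (ε : ℝ≥0) :
    (((2 * ε : ℝ≥0) : ℝ) : ℂ) • (1 : H →L[ℂ] H) ≤ (A.shift ε).1 + (B.shift ε).1 := by
  rw [PosOp.shift_add_shift, ContinuousLinearMap.le_def]
  have : A.1 + B.1 + (2 * ((ε : ℝ) : ℂ)) • (1 : H →L[ℂ] H)
      - (((2 * ε : ℝ≥0) : ℝ) : ℂ) • (1 : H →L[ℂ] H) = A.1 + B.1 := by
    push_cast; abel
  rw [this]
  exact isPositive_sum A B

theorem PosOp.tendstoSOT_shift (A : PosOp H) {v : ℕ → ℝ≥0} (hv : Tendsto v atTop (𝓝 0)) :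
    TendstoSOT (fun n => (A.shift (v n)).1) atTop A.1 := by
  intro x
  have h : Tendsto (fun n => (((v n : ℝ≥0) : ℝ) : ℂ)) atTop (𝓝 0) := by
    have h1 : Continuous fun t : ℝ≥0 => ((t : ℝ) : ℂ) := by fun_prop
    simpa [Function.comp_def] using (h1.tendsto 0).comp hv
  simpa [PosOp.shift] using (h.smul_const x).const_add (A.1 x)

theorem commute_sqrt_sqrt_shift (A B : PosOp H) (ε : ℝ≥0) :
    opSqrt ((A.shift ε).1 + (B.shift ε).1) * opSqrt (A.1 + B.1)
      = opSqrt (A.1 + B.1) * opSqrt ((A.shift ε).1 + (B.shift ε).1) := by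
  have hD := sqrt_mul_sqrt (isPositive_sum A B)
  refine sqrt_comp_eq_comp_sqrt (isPositive_sum _ _) (isPositive_sum _ _) ?_
  change ((A.shift ε).1 + (B.shift ε).1) * opSqrt (A.1 + B.1)
    = opSqrt (A.1 + B.1) * ((A.shift ε).1 + (B.shift ε).1)
  rw [PosOp.shift_add_shift, add_mul, mul_add, smul_one_mul, mul_smul_one]
  congr 1
  calc (A.1 + B.1) * opSqrt (A.1 + B.1)
      = opSqrt (A.1 + B.1) * opSqrt (A.1 + B.1) * opSqrt (A.1 + B.1) := by rw [hD]
    _ = opSqrt (A.1 + B.1) * (A.1 + B.1) := by rw [mul_assoc, hD]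

/-- `1 - P` as a positive operator, where `P` is the range projection of `D`. -/
noncomputable def PosOp.kernelProjection (D : H →L[ℂ] H) : PosOp H :=
  ⟨1 - rangeProjection D, by
    have h : IsSelfAdjoint (1 - rangeProjection D) :=
      (IsSelfAdjoint.one _).sub (isSelfAdjoint_rangeProjection D)
    have h2 : 1 - rangeProjection D
        = ContinuousLinearMap.adjoint (1 - rangeProjection D) ∘L (1 - rangeProjection D) := by
      rw [h.adjoint_eq]
      change _ = (1 - rangeProjection D) * (1 - rangeProjection D)
      rw [mul_sub, sub_mul, sub_mul, rangeProjection_mul_rangeProjection]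
      simp
    rw [h2]
    exact ContinuousLinearMap.isPositive_adjoint_comp_self _⟩

/-- The positive operator `R + (1/2) (1 - P)`, where `P` is the range projection of `D`. -/
noncomputable def PosOp.addHalfKernelProjection (R : PosOp H) (D : H →L[ℂ] H) : PosOp H :=
  ⟨R.1 + (1 / 2 : ℂ) • (PosOp.kernelProjection D).1,
    R.2.add ((PosOp.kernelProjection D).2.smul_of_nonneg (by
      rw [one_div, ← Complex.ofReal_ofNat, ← Complex.ofReal_inv]; exact_mod_cast by positivity))⟩

theorem IsFactorization.addHalf_add_addHalf {A B R S : PosOp H} (h : IsFactorization A B R S) :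
    (R.addHalfKernelProjection (opSqrt (A.1 + B.1))).1
      + (S.addHalfKernelProjection (opSqrt (A.1 + B.1))).1 = 1 := by
  have e := h.add_eq
  simp only [PosOp.addHalfKernelProjection, PosOp.kernelProjection]
  rw [add_add_add_comm, e, ← add_smul, show (1 / 2 + 1 / 2 : ℂ) = 1 by norm_num, one_smul]
  abel

/-- Says that P intertwines the enlarged operator with R, so the joint calculi of the two pairs
agree once compressed by D = DP = PD. -/
theorem PosOp.addHalf_mul_rangeProjection {R : PosOp H} {D : H →L[ℂ] H}
    (h : R.1 * rangeProjection D = R.1) (h' : rangeProjection D * R.1 = R.1) :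
    (R.addHalfKernelProjection D).1 * rangeProjection D = rangeProjection D * R.1 := by
  simp only [PosOp.addHalfKernelProjection, PosOp.kernelProjection]
  rw [add_mul, h, h', smul_mul_assoc, sub_mul, rangeProjection_mul_rangeProjection, one_mul,
    sub_self, smul_zero, add_zero]

/-- The compression of the shifted operator. -/
theorem conj_shift_eq {A : PosOp H} {R D C : H →L[ℂ] H} {ε : ℝ≥0} (hC : IsSelfAdjoint C)
    (hA : D * R * D = A.1) (hCD : C * D = D * C)
    (h : C * (D * D + (2 * ((ε : ℝ) : ℂ)) • 1) * C = 1) :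
    ((A.shift ε).conj C).1 = (C * D) * R * (C * D) + (1 / 2 : ℂ) • (1 - (C * D) * (C * D)) := by
  have e1 : C * D * (C * D) = C * (D * D) * C := by
    nth_rw 2 [hCD]; simp only [mul_assoc]
  have e2 : C * D * R * (C * D) = C * A.1 * C := by
    nth_rw 2 [hCD]; rw [← hA]; simp only [mul_assoc]
  -- The hypothesis becomes 2εC² = 1 - (CD)². Shifting A alone contributes εC², which explains the
  -- factor 1/2.
  rw [mul_add, add_mul, mul_smul_comm, smul_mul_assoc, mul_one, ← eq_sub_iff_add_eq', ← e1] at h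
  rw [PosOp.conj_val_of_isSelfAdjoint _ hC, e2, ← h, smul_smul]
  simp only [PosOp.shift]
  rw [mul_add, add_mul, mul_smul_comm, smul_mul_assoc, mul_one]
  congr 2
  ring

theorem mul_mul_eq_of_mul_eq_mul {M : Type*} [Monoid M] {D P X Y : M} (h1 : D * P = D)
    (h2 : P * D = D) (h : X * P = P * Y) : D * Y * D = D * X * D := by
  calc D * Y * D = D * (P * Y) * D := by rw [← mul_assoc, h1]
    _ = D * X * (P * D) := by rw [← h]; simp only [mul_assoc]
    _ = D * X * D := by rw [h2]

/-- (CD)(CD)* = C(A + B)C is at most C(A + B + 2ε)C = 1. -/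
theorem norm_mul_le_one {A B : PosOp H} {ε : ℝ≥0} {C : H →L[ℂ] H} (hC : IsSelfAdjoint C)
    (h : C * ((A.shift ε).1 + (B.shift ε).1) * C = 1) :
    ‖C * opSqrt (A.1 + B.1)‖ ≤ 1 := by
  have hD := isSelfAdjoint_sqrt (A.1 + B.1)
  let T : PosOp H := ⟨A.1 + B.1, isPositive_sum A B⟩
  let U : PosOp H := ⟨(2 * ((ε : ℝ) : ℂ)) • 1,
    ContinuousLinearMap.isPositive_one.smul_of_nonneg (by
      rw [← Complex.ofReal_ofNat, ← Complex.ofReal_mul]; exact_mod_cast (2 * ε).2)⟩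
  have h1 : (T.conj C).1 + (U.conj C).1 = 1 := by
    rw [PosOp.conj_val_of_isSelfAdjoint _ hC, PosOp.conj_val_of_isSelfAdjoint _ hC, ← add_mul,
      ← mul_add, ← h, PosOp.shift_add_shift]
  have h2 := PosOp.norm_le_one_of_add_eq_one h1
  have h3 : (T.conj C).1 = C * opSqrt (A.1 + B.1) * star (C * opSqrt (A.1 + B.1)) := by
    rw [PosOp.conj_val_of_isSelfAdjoint _ hC, star_mul, hC.star_eq, hD.star_eq]
    change C * (A.1 + B.1) * C = _
    nth_rw 1 [← sqrt_mul_sqrt (isPositive_sum A B)]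
    simp only [mul_assoc]
  rw [h3, CStarRing.norm_self_mul_star] at h2
  nlinarith [norm_nonneg (C * opSqrt (A.1 + B.1))]

end Shift

/-! ### Convergence under shifts -/

section ShiftContinuity

variable {H : Type u} [NormedAddCommGroup H] [InnerProductSpace ℂ H] [CompleteSpace H]
variable {φ : ℝ≥0 × ℝ≥0 → ℝ} {Φ : Operation.{u}}

/-- The C n need not be bounded, but the C n D are contractions. Since C n D E n = D, they send Dx
to Dx + C n D (Dx - E n x), so they converge to the identity on the closed range of D; and C n D = C
n D P. -/
theorem tendstoSOT_rangeProjection {D : H →L[ℂ] H} (hD : IsSelfAdjoint D) {C E : ℕ → H →L[ℂ] H}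
    (hE : TendstoSOT E atTop D) (h : ∀ n, C n * E n = 1) (h' : ∀ n, C n * D = D * C n)
    (h1 : ∀ n, ‖C n * D‖ ≤ 1) :
    TendstoSOT (fun n => C n * D) atTop (rangeProjection D) := by
  have key : ∀ y ∈ Set.range D, Tendsto (fun n => (C n * D) y) atTop (𝓝 y) := by
    rintro _ ⟨x, rfl⟩
    have e : ∀ n, (C n * D) (D x) = D x + (C n * D) (D x - E n x) := fun n => by
      have : C n * D * E n = D := by rw [h', mul_assoc, h, mul_one]
      have hx : (C n * D) (E n x) = D x := congrArg (fun Z : H →L[ℂ] H => Z x) this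
      rw [map_sub, hx]; abel
    have h0 : Tendsto (fun n => (C n * D) (D x - E n x)) atTop (𝓝 0) := by
      refine squeeze_zero_norm (a := fun n => 1 * ‖D x - E n x‖)
        (fun n => (C n * D).le_of_opNorm_le (h1 n) _) ?_
      simpa using ((hE x).const_sub (D x)).norm
    have h2 := h0.const_add (D x)
    rw [add_zero] at h2
    exact h2.congr fun n => (e n).symm
  intro x
  have h3 := tendsto_self_of_mem_closure h1 key (rangeProjection_mem D x)
  refine h3.congr fun n => ?_
  change (C n * D * rangeProjection D) x = (C n * D) x
  rw [mul_assoc, self_mul_rangeProjection hD]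

/-- The pairs attached to the shifts have sum 1 and converge to the enlarged pair, also of sum 1.
Intertwining by P shows that D φ(·, ·) D takes the same value there as at (R, S). -/
theorem IsPWCalculus.tendstoSOT_shift_seq (hφ : Continuous φ) (hΦ : IsPWCalculus φ Φ)
    (A B : PosOp H) {v : ℕ → ℝ≥0} (hv : Tendsto v atTop (𝓝 0)) (hpos : ∀ n, 0 < v n) :
    TendstoSOT (fun n => (Φ H (A.shift (v n)) (B.shift (v n))).1) atTop (Φ H A B).1 := by
  obtain ⟨R, S, h⟩ := exists_isFactorization A B
  have hT := (A.tendstoSOT_shift hv).add (B.tendstoSOT_shift hv)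
  obtain ⟨r, hr⟩ := hT.exists_norm_le
  have hE := tendstoSOT_sqrt (fun n => isPositive_sum (A.shift (v n)) (B.shift (v n)))
    (isPositive_sum A B) hr hT
  choose C hC h1 h2 _ using fun n =>
    exists_inverse_sqrt (isPositive_sum (A.shift (v n)) (B.shift (v n)))
      (ε := ((2 * v n : ℝ≥0) : ℝ)) (by exact_mod_cast mul_pos two_pos (hpos n))
      (A.le_shift_add_shift B (v n))
  have hCD : ∀ n, C n * opSqrt (A.1 + B.1) = opSqrt (A.1 + B.1) * C n := fun n => by
    have e := commute_sqrt_sqrt_shift A B (v n)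
    calc C n * opSqrt (A.1 + B.1)
        = C n * (opSqrt (A.1 + B.1) * opSqrt ((A.shift (v n)).1 + (B.shift (v n)).1)) * C n := by
          rw [← mul_assoc, mul_assoc _ _ (C n), h1, mul_one]
      _ = opSqrt (A.1 + B.1) * C n := by rw [← e, ← mul_assoc, h2, one_mul]
  have h3 : ∀ n, C n * ((A.shift (v n)).1 + (B.shift (v n)).1) * C n = 1 := fun n => by
    nth_rw 1 [← sqrt_mul_sqrt (isPositive_sum (A.shift (v n)) (B.shift (v n)))]
    rw [← mul_assoc, h2, one_mul, h1]
  have h4 : ∀ n, C n * (opSqrt (A.1 + B.1) * opSqrt (A.1 + B.1) + (2 * ((v n : ℝ) : ℂ)) • 1)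
      * C n = 1 := fun n => by
    rw [sqrt_mul_sqrt (isPositive_sum A B), ← PosOp.shift_add_shift, h3]
  have hQ := tendstoSOT_rangeProjection (isSelfAdjoint_sqrt (A.1 + B.1)) hE h2 hCD
    (fun n => norm_mul_le_one (hC n) (h3 n))
  have lim : ∀ {Z Y : PosOp H}, opSqrt (A.1 + B.1) * Y.1 * opSqrt (A.1 + B.1) = Z.1 →
      Y.1 * rangeProjection (opSqrt (A.1 + B.1)) = Y.1 →
      rangeProjection (opSqrt (A.1 + B.1)) * Y.1 = Y.1 →
      TendstoSOT (fun n => ((Z.shift (v n)).conj (C n)).1) atTop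
        (Y.addHalfKernelProjection (opSqrt (A.1 + B.1))).1 := by
    intro Z Y hZ hY hY'
    simp only [fun n => conj_shift_eq (A := Z) (hC n) hZ (hCD n) (h4 n)]
    have e : (Y.addHalfKernelProjection (opSqrt (A.1 + B.1))).1
        = rangeProjection (opSqrt (A.1 + B.1)) * Y.1 * rangeProjection (opSqrt (A.1 + B.1))
          + (1 / 2 : ℂ) • (1 - rangeProjection (opSqrt (A.1 + B.1))
            * rangeProjection (opSqrt (A.1 + B.1))) := by
      rw [hY', hY, rangeProjection_mul_rangeProjection]; rfl
    rw [e]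
    exact ((hQ.mul_of_seq (tendstoSOT_const _)).mul_of_seq hQ).add
      (((tendstoSOT_const _).sub (hQ.mul_of_seq hQ)).const_smul _)
  have hsum := fun n => conj_add_conj_eq_one (hC n) (h1 n) (h2 n)
  have hcomm := commute_of_add_eq_one h.addHalf_add_addHalf
  have hJ := tendstoSOT_jointCalculus hφ (fun n => commute_of_add_eq_one (hsum n)) hcomm
    (fun n => PosOp.norm_le_one_of_add_eq_one (hsum n))
    (fun n => PosOp.norm_le_one_of_add_eq_one ((add_comm _ _).trans (hsum n)))
    (lim h.left h.left_mul h.mul_left) (lim h.right h.right_mul h.mul_right)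
  have hJP := jointCalculus_comp_eq_comp_jointCalculus hφ hcomm h.commute
    (PosOp.addHalf_mul_rangeProjection h.left_mul h.mul_left)
    (PosOp.addHalf_mul_rangeProjection h.right_mul h.mul_right)
  have e : (Φ H A B).1 = opSqrt (A.1 + B.1) * jointCalculus φ
      (R.addHalfKernelProjection (opSqrt (A.1 + B.1)))
      (S.addHalfKernelProjection (opSqrt (A.1 + B.1))) * opSqrt (A.1 + B.1) := by
    rw [hΦ.apply_eq h]
    exact mul_mul_eq_of_mul_eq_mul (self_mul_rangeProjection (isSelfAdjoint_sqrt (A.1 + B.1)))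
      (rangeProjection_mul_self _) hJP
  rw [e]
  simp only [fun n => hΦ.apply_eq_of_inverse (hC n) (h1 n) (h2 n)]
  exact (hE.mul_of_seq hJ).mul_of_seq hE

theorem IsPWCalculus.shiftContinuous (hφ : Continuous φ) (hΦ : IsPWCalculus φ Φ) :
    ShiftContinuous Φ := by
  intro H _ _ _ A B x
  -- The filter is countably generated, so sequences suffice; dropping finitely many terms makes all
  -- of them positive.
  refine tendsto_of_seq_tendsto fun v hv => ?_
  obtain ⟨hv0, hpos⟩ := tendsto_nhdsWithin_iff.mp hv
  obtain ⟨N, hN⟩ := eventually_atTop.mp hpos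
  rw [← tendsto_add_atTop_iff_nat N]
  exact hΦ.tendstoSOT_shift_seq hφ A B (v := fun n => v (n + N))
    ((tendsto_add_atTop_iff_nat N).mpr hv0) (fun n => hN _ (Nat.le_add_left _ _)) x

end ShiftContinuity

/-! ### Reducing subspaces and isometries -/

section Restriction

variable {H : Type u} [NormedAddCommGroup H] [InnerProductSpace ℂ H] [CompleteSpace H]
variable {G : Type u} [NormedAddCommGroup G] [InnerProductSpace ℂ G] [CompleteSpace G]
variable {Φ : Operation.{u}}

theorem PosOp.conj_subtypeL_apply (A : PosOp H) (K : Submodule ℂ H) [CompleteSpace K]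
    (h : ∀ x ∈ K, A.1 x ∈ K) (x : K) : ((A.conj K.subtypeL).1 x : H) = A.1 x := by
  simp only [PosOp.conj, Submodule.adjoint_subtypeL]
  exact congrArg Subtype.val (Submodule.orthogonalProjectionOnto_mem_subspace_eq_self
    (⟨A.1 x, h x x.2⟩ : K))

theorem PosOp.apply_mem_orthogonal (A : PosOp H) {K : Submodule ℂ H} (h : ∀ x ∈ K, A.1 x ∈ K)
    {x : H} (hx : x ∈ Kᗮ) : A.1 x ∈ Kᗮ := by
  intro y hy
  have := A.2.isSymmetric y x
  simp only [ContinuousLinearMap.coe_coe] at this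
  rw [← this]
  exact hx _ (h y hy)

/-- An operation respecting direct sums is compatible with restriction to reducing subspaces. -/
theorem RespectsDirectSums.apply_subtype (hΦ : RespectsDirectSums Φ) (A B : PosOp H)
    (K : Submodule ℂ H) [CompleteSpace K] (hA : ∀ x ∈ K, A.1 x ∈ K) (hB : ∀ x ∈ K, B.1 x ∈ K)
    (x : K) : (Φ H A B).1 x = (Φ K (A.conj K.subtypeL) (B.conj K.subtypeL)).1 x := by
  -- H is split into K and its complement; `ULift` puts the index type in `Type u`.
  let F : ULift.{u} Bool → Submodule ℂ H := fun b => cond b.down K Kᗮ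
  have hF : ∀ b, CompleteSpace (F b) := by
    rintro ⟨_ | _⟩
    · exact inferInstanceAs (CompleteSpace Kᗮ)
    · exact inferInstanceAs (CompleteSpace K)
  have hinv : ∀ Z : PosOp H, (∀ x ∈ K, Z.1 x ∈ K) → ∀ b, ∀ x ∈ F b, Z.1 x ∈ F b := by
    rintro Z hZ ⟨_ | _⟩ y hy
    · exact Z.apply_mem_orthogonal hZ hy
    · exact hZ y hy
  have hsum : IsHilbertSum ℂ (fun b => F b) fun b => (F b).subtypeₗᵢ := by
    have h := K.isHilbertSumOrthogonal
    refine IsHilbertSum.mkInternal _ ?_ ?_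
    · exact h.OrthogonalFamily.comp (f := ULift.down) ULift.down_injective
    · refine le_trans ?_ (Submodule.le_topologicalClosure _)
      have h1 : K ≤ ⨆ b, F b := le_iSup F ⟨true⟩
      have h2 : Kᗮ ≤ ⨆ b, F b := le_iSup F ⟨false⟩
      exact K.isCompl_orthogonal.codisjoint.top_le.trans (sup_le h1 h2)
  exact hΦ H (ULift.{u} Bool) (fun b => F b) (fun b => (F b).subtypeₗᵢ) hsum A B
    (fun b => A.conj (F b).subtypeL) (fun b => B.conj (F b).subtypeL)
    (fun b y => (A.conj_subtypeL_apply (F b) (hinv A hA b) y).symm)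
    (fun b y => (B.conj_subtypeL_apply (F b) (hinv B hB b) y).symm) ⟨true⟩ x

/-- An operator homogeneous operation respecting direct sums is natural with respect to isometries
intertwining pairs of operators. -/
theorem RespectsDirectSums.apply_linearIsometry (hΦ : RespectsDirectSums Φ)
    (hΦ' : OperatorHomogeneous Φ) {A B : PosOp H} {A' B' : PosOp G} (V : G →ₗᵢ[ℂ] H)
    (hA : ∀ x, A.1 (V x) = V (A'.1 x)) (hB : ∀ x, B.1 (V x) = V (B'.1 x)) (x : G) :
    (Φ H A B).1 (V x) = V ((Φ G A' B').1 x) := by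
  -- V is a unitary U onto its range followed by an inclusion. Homogeneity with C = U treats the
  -- first, direct sums the second.
  let K := LinearMap.range V.toLinearMap
  have hK : CompleteSpace K := by
    have : IsComplete (K : Set H) := by
      have := V.isometry.isUniformInducing.isComplete_range
      exact this
    exact this.completeSpace_coe
  let U : G ≃ₗᵢ[ℂ] K := V.equivRange
  have hU : ∀ x, (U x : H) = V x := fun x => rfl
  have hinv : ∀ {Z : PosOp H} {Z' : PosOp G}, (∀ x, Z.1 (V x) = V (Z'.1 x)) →
      (∀ x ∈ K, Z.1 x ∈ K) := by
    rintro Z Z' h _ ⟨y, rfl⟩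
    exact ⟨Z'.1 y, (h y).symm⟩
  have hconj : ∀ {Z : PosOp H} {Z' : PosOp G}, (∀ x, Z.1 (V x) = V (Z'.1 x)) →
      (Z.conj K.subtypeL).conj (U.toContinuousLinearEquiv : G →L[ℂ] K) = Z' := by
    intro Z Z' h
    refine Subtype.ext (ContinuousLinearMap.ext fun y => ?_)
    have h1 : (Z.conj K.subtypeL).1 (U y) = U (Z'.1 y) := by
      refine Subtype.ext ?_
      rw [PosOp.conj_subtypeL_apply Z K (hinv h), hU, hU, h]
    change ContinuousLinearMap.adjoint (U.toContinuousLinearEquiv : G →L[ℂ] K)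
      ((Z.conj K.subtypeL).1 (U y)) = Z'.1 y
    rw [h1, LinearIsometryEquiv.adjoint_eq_symm]
    exact U.symm_apply_apply _
  have h := hΦ' K G (A.conj K.subtypeL) (B.conj K.subtypeL)
    (U.toContinuousLinearEquiv : G →L[ℂ] K) (by
      have : Set.range (U.toContinuousLinearEquiv : G →L[ℂ] K) = Set.univ :=
        U.surjective.range_eq
      rw [this, closure_univ]; exact Set.subset_univ _)
  rw [hconj hA, hconj hB, LinearIsometryEquiv.adjoint_eq_symm] at h
  rw [← hU, hΦ.apply_subtype A B K (hinv hA) (hinv hB), h, ← hU]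
  exact congrArg Subtype.val (U.apply_symm_apply _).symm

end Restriction

/-! ### The one-dimensional Hilbert space -/

section Line

/-- The one-dimensional Hilbert space in the universe `u`. -/
abbrev Line : Type u := EuclideanSpace ℂ PUnit.{u + 1}

/-- The standard unit vector of `Line`. -/
noncomputable def Line.e : Line.{u} := EuclideanSpace.single PUnit.unit 1

theorem Line.eq_smul_e (v : Line.{u}) : v = v PUnit.unit • Line.e := by
  ext i; simp [Line.e]

theorem Line.norm_eq (v : Line.{u}) : ‖v‖ = ‖v PUnit.unit‖ := by
  simp [EuclideanSpace.norm_eq]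

variable {H : Type u} [NormedAddCommGroup H] [InnerProductSpace ℂ H]

/-- The isometry of the line onto the span of a unit vector. -/
noncomputable def Line.isometry (ξ : H) (hξ : ‖ξ‖ = 1) : Line.{u} →ₗᵢ[ℂ] H where
  toFun v := v PUnit.unit • ξ
  map_add' v w := by simp [add_smul]
  map_smul' c v := by simp [mul_smul]
  norm_map' v := by
    change ‖v PUnit.unit • ξ‖ = ‖v‖
    rw [norm_smul, hξ, mul_one, Line.norm_eq]

theorem Line.isometry_apply (ξ : H) (hξ : ‖ξ‖ = 1) (v : Line.{u}) :
    Line.isometry ξ hξ v = v PUnit.unit • ξ := rfl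

theorem Line.isometry_e (ξ : H) (hξ : ‖ξ‖ = 1) : Line.isometry ξ hξ Line.e = ξ := by
  simp [Line.isometry_apply, Line.e]

end Line

/-! ### The symbol of an operation and common eigenvectors -/

section Symbol

variable {H : Type u} [NormedAddCommGroup H] [InnerProductSpace ℂ H] [CompleteSpace H]
variable {φ : ℝ≥0 × ℝ≥0 → ℝ} {Φ : Operation.{u}}

/-- The positive operator `x I`. -/
noncomputable def PosOp.scalar (H : Type u) [NormedAddCommGroup H] [InnerProductSpace ℂ H]
    [CompleteSpace H] (x : ℝ≥0) : PosOp H :=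
  ⟨((x : ℝ) : ℂ) • (1 : H →L[ℂ] H),
    ContinuousLinearMap.isPositive_one.smul_of_nonneg (by exact_mod_cast x.2)⟩

/-- The function on `[0, ∞)²` obtained by applying an operation to pairs of numbers. -/
noncomputable def Operation.symbol (Φ : Operation.{u}) (p : ℝ≥0 × ℝ≥0) : ℝ :=
  (inner ℂ Line.e ((Φ Line (PosOp.scalar Line p.1) (PosOp.scalar Line p.2)).1 Line.e)).re

theorem Operation.apply_scalar (Φ : Operation.{u}) (x y : ℝ≥0) :
    (Φ Line (PosOp.scalar Line x) (PosOp.scalar Line y)).1 = ((Φ.symbol (x, y) : ℝ) : ℂ) • 1 := by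
  have hT := (Φ Line (PosOp.scalar Line x) (PosOp.scalar Line y)).2
  have hs : Φ.symbol (x, y)
      = (inner ℂ Line.e ((Φ Line (PosOp.scalar Line x) (PosOp.scalar Line y)).1 Line.e)).re := rfl
  generalize (Φ Line (PosOp.scalar Line x) (PosOp.scalar Line y)).1 = T at hT hs
  have h1 : T Line.e = (inner ℂ Line.e (T Line.e)) • Line.e := by
    conv_lhs => rw [Line.eq_smul_e (T Line.e)]
    congr 1
    simp [Line.e, EuclideanSpace.inner_single_left]
  have h2 : ((inner ℂ Line.e (T Line.e)).re : ℂ) = inner ℂ Line.e (T Line.e) := by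
    have := hT.isSymmetric.coe_re_inner_self_apply Line.e
    exact this
  ext1 v
  rw [Line.eq_smul_e v, map_smul, h1, hs, h2, map_smul]
  rfl

/-- Common eigenvectors of a pair are eigenvectors of its image under a natural operation. -/
theorem apply_eigenvector (hΦ : RespectsDirectSums Φ) (hΦ' : OperatorHomogeneous Φ)
    {A B : PosOp H} {x y : ℝ≥0} {ξ : H} (hξ : ‖ξ‖ = 1) (hA : A.1 ξ = ((x : ℝ) : ℂ) • ξ)
    (hB : B.1 ξ = ((y : ℝ) : ℂ) • ξ) : (Φ H A B).1 ξ = ((Φ.symbol (x, y) : ℝ) : ℂ) • ξ := by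
  have key : ∀ {Z : PosOp H} {z : ℝ≥0}, Z.1 ξ = ((z : ℝ) : ℂ) • ξ → ∀ v : Line,
      Z.1 (Line.isometry ξ hξ v) = Line.isometry ξ hξ ((PosOp.scalar Line z).1 v) := by
    intro Z z h v
    rw [Line.isometry_apply, map_smul, h, smul_comm, ← Line.isometry_apply ξ hξ, ← map_smul]
    rfl
  have h := hΦ.apply_linearIsometry hΦ' (Line.isometry ξ hξ) (key hA) (key hB) Line.e
  rw [Line.isometry_e, Φ.apply_scalar] at h
  rw [h, smul_apply, map_smul, one_apply_eq_self, Line.isometry_e]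

/-- The rank-one operator v ↦ ⟨ξ, v⟩ξ intertwines (A, B) with the scalar pair (x, y). -/
theorem jointCalculus_eigenvector (hφ : Continuous φ) {A B : PosOp H} (hAB : Commute A.1 B.1)
    {x y : ℝ≥0} {ξ : H} (hA : A.1 ξ = ((x : ℝ) : ℂ) • ξ) (hB : B.1 ξ = ((y : ℝ) : ℂ) • ξ) :
    jointCalculus φ A B ξ = ((φ (x, y) : ℝ) : ℂ) • ξ := by
  let W : H →L[ℂ] H := (innerSL ℂ ξ).smulRight ξ
  have hW : ∀ v, W v = (inner ℂ ξ v) • ξ := fun v => by simp [W]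
  have key : ∀ {Z : PosOp H} {z : ℝ≥0}, Z.1 ξ = ((z : ℝ) : ℂ) • ξ →
      Z.1 ∘L W = W ∘L (PosOp.scalar H z).1 := by
    intro Z z h
    ext v
    change Z.1 (W v) = W (((z : ℝ) : ℂ) • v)
    rw [map_smul, hW, map_smul, h, smul_comm]
  have hc : Commute (PosOp.scalar H x).1 (PosOp.scalar H y).1 :=
    ((Commute.one_left _).smul_left _)
  have h := jointCalculus_comp_eq_comp_jointCalculus hφ hAB hc (key hA) (key hB)
  rw [jointCalculus_scalar φ (A := PosOp.scalar H x) (B := PosOp.scalar H y) rfl rfl] at h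
  have h1 := congrArg (fun Z : H →L[ℂ] H => Z ξ) h
  simp only [ContinuousLinearMap.comp_apply, hW, smul_apply, one_apply_eq_self, map_smul,
    inner_smul_right] at h1
  by_cases h0 : ξ = 0
  · simp [h0]
  · have h2 : inner ℂ ξ ξ ≠ 0 := inner_self_ne_zero.mpr h0
    rw [mul_comm, mul_smul] at h1
    exact smul_right_injective H h2 h1

theorem PosOp.exists_nnreal_eigenvalue (A : PosOp H) {ξ : H} (hξ : ξ ≠ 0) {μ : ℂ}
    (h : A.1 ξ = μ • ξ) : ∃ x : ℝ≥0, μ = ((x : ℝ) : ℂ) := by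
  have h1 := A.2.inner_nonneg_right ξ
  rw [h, inner_smul_right, inner_self_eq_norm_sq_to_K] at h1
  have h2 : 0 < ‖ξ‖ ^ 2 := pow_pos (norm_pos_iff.mpr hξ) 2
  have h3 : μ * ((‖ξ‖ : ℂ)) ^ 2 = μ * ((‖ξ‖ ^ 2 : ℝ) : ℂ) := by push_cast; rfl
  obtain ⟨hre, him⟩ := RCLike.nonneg_iff.mp h1
  simp only [Complex.coe_algebraMap, RCLike.re_to_complex, RCLike.im_to_complex, h3,
    Complex.re_mul_ofReal, Complex.im_mul_ofReal] at hre him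
  refine ⟨⟨μ.re, nonneg_of_mul_nonneg_left hre h2⟩, Complex.ext rfl ?_⟩
  simpa [h2.ne', hξ] using him

/-- A natural operation is given by the functional calculus on pairs `(R, 1 - R)` with `R`
compact. -/
theorem apply_eq_jointCalculus_of_isCompactOperator (hΦ : RespectsDirectSums Φ)
    (hΦ' : OperatorHomogeneous Φ) (hs : Continuous Φ.symbol) {R S : PosOp H}
    (hRS : R.1 + S.1 = 1) (hR : IsCompactOperator R.1) :
    (Φ H R S).1 = jointCalculus Φ.symbol R S := by
  -- By the spectral theorem the eigenvectors of R are total, and each is an eigenvector of S = 1 -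
  -- R too.
  have horth := ContinuousLinearMap.orthogonalComplement_iSup_eigenspaces_eq_bot hR R.2.isSymmetric
  rw [← Submodule.topologicalClosure_eq_top_iff] at horth
  have hle : (⨆ μ, Module.End.eigenspace (R.1 : Module.End ℂ H) μ)
      ≤ LinearMap.eqLocus (Φ H R S).1.toLinearMap (jointCalculus Φ.symbol R S).toLinearMap := by
    refine iSup_le fun μ ξ hξ => ?_
    have hξ' : R.1 ξ = μ • ξ := Module.End.mem_eigenspace_iff.mp hξ
    rw [LinearMap.mem_eqLocus]
    change (Φ H R S).1 ξ = jointCalculus Φ.symbol R S ξ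
    by_cases h0 : ξ = 0
    · simp [h0]
    have hS : S.1 ξ = (1 - μ) • ξ := by
      have := congrArg (fun Z : H →L[ℂ] H => Z ξ) hRS
      simp only [add_apply, one_apply_eq_self, hξ'] at this
      rw [sub_smul, one_smul, eq_sub_iff_add_eq', this]
    obtain ⟨x, hx⟩ := R.exists_nnreal_eigenvalue h0 hξ'
    obtain ⟨y, hy⟩ := S.exists_nnreal_eigenvalue h0 hS
    rw [hx] at hξ'
    rw [hy] at hS
    rw [jointCalculus_eigenvector hs (commute_of_add_eq_one hRS) hξ' hS]
    have hn : ((‖ξ‖ : ℂ)⁻¹) ≠ 0 := by simpa using h0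
    have h1 := apply_eigenvector hΦ hΦ' (A := R) (B := S) (x := x) (y := y)
      (ξ := ((‖ξ‖ : ℂ)⁻¹) • ξ) (norm_smul_inv_norm h0) (by rw [map_smul, hξ', smul_comm])
      (by rw [map_smul, hS, smul_comm])
    rw [map_smul, smul_comm] at h1
    exact smul_right_injective H hn h1
  refine ContinuousLinearMap.ext fun ξ => ?_
  have hcl : IsClosed {ξ | (Φ H R S).1 ξ = jointCalculus Φ.symbol R S ξ} :=
    isClosed_eq (Φ H R S).1.continuous (jointCalculus Φ.symbol R S).continuous
  have hmem : ξ ∈ closure ((⨆ μ, Module.End.eigenspace (R.1 : Module.End ℂ H) μ : Submodule ℂ H)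
      : Set H) := by
    rw [← Submodule.topologicalClosure_coe, horth]; trivial
  exact closure_minimal (fun x hx => hle hx) hcl hmem

end Symbol

/-! ### Homogeneity and continuity of the symbol -/

section Symbol

variable {Φ : Operation.{u}}

theorem OperatorHomogeneous.homogeneous_symbol (hΦ : OperatorHomogeneous Φ) :
    Homogeneous Φ.symbol := by
  have key : ∀ c : ℝ≥0, ∀ p q : ℝ≥0,
      closure (Set.range ((PosOp.scalar Line.{u} p).1 + (PosOp.scalar Line.{u} q).1)) ⊆
        closure (Set.range (PosOp.scalar Line.{u} (NNReal.sqrt c)).1) →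
      Φ.symbol (c * p, c * q) = c * Φ.symbol (p, q) := by
    intro c p q hr
    have h := hΦ Line Line (PosOp.scalar Line p) (PosOp.scalar Line q)
      (PosOp.scalar Line (NNReal.sqrt c)).1 hr
    have hc : ∀ p : ℝ≥0, (PosOp.scalar Line.{u} p).conj (PosOp.scalar Line (NNReal.sqrt c)).1
        = PosOp.scalar Line (c * p) := fun p => by
      refine Subtype.ext ?_
      rw [PosOp.conj_val_of_isSelfAdjoint _ (PosOp.scalar Line _).2.isSelfAdjoint]
      simp only [PosOp.scalar, smul_mul_smul_comm, one_mul]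
      congr 1
      norm_cast
      rw [mul_right_comm, NNReal.mul_self_sqrt]
    rw [hc, hc, Φ.apply_scalar, Φ.apply_scalar,
      (PosOp.scalar Line _).2.isSelfAdjoint.adjoint_eq] at h
    have h1 := congrArg (fun Z : Line.{u} →L[ℂ] Line.{u} => Z Line.e PUnit.unit) h
    simp [PosOp.scalar, Line.e] at h1
    norm_cast at h1
    rw [h1, mul_comm, mul_assoc, Real.mul_self_sqrt c.coe_nonneg, mul_comm]
  intro c x y
  by_cases hc : c = 0
  -- For c = 0 the range condition admits only the zero pair; it yields φ(0, 0) = 0, which is all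
  -- that is claimed.
  · have h := key 0 0 0 (by simp [PosOp.scalar])
    simp only [hc, zero_mul, NNReal.coe_zero] at h ⊢
    exact h
  · refine key c x y ?_
    have : Set.range (PosOp.scalar Line.{u} (NNReal.sqrt c)).1 = Set.univ := by
      refine Set.eq_univ_of_forall fun v => ⟨((NNReal.sqrt c : ℝ) : ℂ)⁻¹ • v, ?_⟩
      have hne : ((NNReal.sqrt c : ℝ) : ℂ) ≠ 0 := by simpa using hc
      change ((NNReal.sqrt c : ℝ) : ℂ) • ((NNReal.sqrt c : ℝ) : ℂ)⁻¹ • v = v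
      rw [smul_inv_smul₀ hne]
    rw [this, closure_univ]
    exact Set.subset_univ _

theorem PosOp.tendstoSOT_scalar {H : Type u} [NormedAddCommGroup H] [InnerProductSpace ℂ H]
    [CompleteSpace H] {v : ℕ → ℝ≥0} {x : ℝ≥0} (h : Tendsto v atTop (𝓝 x)) :
    TendstoSOT (fun n => (PosOp.scalar H (v n)).1) atTop (PosOp.scalar H x).1 := by
  intro ξ
  have h1 : Continuous fun t : ℝ≥0 => ((t : ℝ) : ℂ) • ξ := by fun_prop
  exact (h1.tendsto x).comp h

theorem SOTContinuousBoundedBelow.tendsto_symbol (hΦ : SOTContinuousBoundedBelow Φ)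
    {v : ℕ → ℝ≥0 × ℝ≥0} {p : ℝ≥0 × ℝ≥0} (hv : Tendsto v atTop (𝓝 p)) {ε : ℝ≥0} (hε : 0 < ε)
    (hle : ∀ n, ε ≤ (v n).1 + (v n).2) :
    Tendsto (fun n => Φ.symbol (v n)) atTop (𝓝 (Φ.symbol p)) := by
  have h := hΦ Line (PosOp.scalar Line p.1) (PosOp.scalar Line p.2)
    (fun n => PosOp.scalar Line (v n).1) (fun n => PosOp.scalar Line (v n).2) ε
    (by exact_mod_cast hε) (PosOp.tendstoSOT_scalar (continuous_fst.tendsto p |>.comp hv))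
    (PosOp.tendstoSOT_scalar (continuous_snd.tendsto p |>.comp hv)) (fun n => by
      rw [ContinuousLinearMap.le_def]
      have : (PosOp.scalar Line.{u} (v n).1).1 + (PosOp.scalar Line.{u} (v n).2).1
          - ((ε : ℝ) : ℂ) • (1 : Line.{u} →L[ℂ] Line.{u})
          = (PosOp.scalar Line.{u} ((v n).1 + (v n).2 - ε)).1 := by
        simp only [PosOp.scalar]
        rw [← add_smul, ← sub_smul, NNReal.coe_sub (hle n)]
        push_cast
        rfl
      rw [this]
      exact (PosOp.scalar Line.{u} _).2)
  have h1 := (tendsto_const_nhds (x := Line.e.{u})).inner (𝕜 := ℂ) (h Line.e)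
  exact (Complex.continuous_re.tendsto _).comp h1

/-- Condition (c) gives continuity only where x + y > 0. At the origin, homogeneity gives |φ(x, y)|
≤ (x + y)M, with M a bound on the compact segment x + y = 1. -/
theorem continuous_symbol (hΦ : OperatorHomogeneous Φ) (hΦ' : SOTContinuousBoundedBelow Φ) :
    Continuous Φ.symbol := by
  have hhom := hΦ.homogeneous_symbol
  have hpos : ∀ p : ℝ≥0 × ℝ≥0, 0 < p.1 + p.2 → ContinuousAt Φ.symbol p := by
    intro p hp
    refine tendsto_of_seq_tendsto fun v hv => ?_
    have hlim : Tendsto (fun n => (v n).1 + (v n).2) atTop (𝓝 (p.1 + p.2)) :=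
      ((continuous_fst.add continuous_snd).tendsto p).comp hv
    obtain ⟨ε, hε, hεp⟩ := exists_between hp
    obtain ⟨N, hN⟩ := eventually_atTop.mp (hlim.eventually (lt_mem_nhds hεp))
    rw [← tendsto_add_atTop_iff_nat N]
    exact hΦ'.tendsto_symbol (v := fun n => v (n + N)) ((tendsto_add_atTop_iff_nat N).mpr hv) hε
      fun n => (hN _ (Nat.le_add_left _ _)).le
  have hbd : ∃ M : ℝ, ∀ p : ℝ≥0 × ℝ≥0, ‖Φ.symbol p‖ ≤ ((p.1 + p.2 : ℝ≥0) : ℝ) * M := by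
    have hcont : ContinuousOn (fun t : ℝ≥0 => Φ.symbol (t, 1 - t)) (Set.Icc 0 1) := by
      intro t ht
      refine ContinuousAt.continuousWithinAt ?_
      have h1 : ContinuousAt Φ.symbol (t, 1 - t) :=
        hpos _ (by simp [add_tsub_cancel_of_le ht.2])
      exact ContinuousAt.comp (g := Φ.symbol) (f := fun t : ℝ≥0 => (t, 1 - t)) h1 (by fun_prop)
    obtain ⟨M, hM⟩ := isCompact_Icc.exists_bound_of_continuousOn hcont
    refine ⟨M, fun p => ?_⟩
    by_cases hp : p.1 + p.2 = 0
    · have h0 := hhom 0 p.1 p.2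
      obtain ⟨h1, h2⟩ := add_eq_zero.mp hp
      have : p = (0, 0) := Prod.ext h1 h2
      rw [hp, this]
      simpa using h0
    · have h1 : p.1 / (p.1 + p.2) ≤ 1 := div_le_one_of_le₀ le_self_add zero_le
      have h2 : 1 - p.1 / (p.1 + p.2) = p.2 / (p.1 + p.2) := by
        rw [tsub_eq_iff_eq_add_of_le h1, ← add_div, add_comm p.2, div_self hp]
      have h3 := hhom (p.1 + p.2) (p.1 / (p.1 + p.2)) (p.2 / (p.1 + p.2))
      rw [mul_div_cancel₀ _ hp, mul_div_cancel₀ _ hp] at h3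
      have h4 := hM _ ⟨zero_le, h1⟩
      rw [h2] at h4
      rw [show p = (p.1, p.2) from rfl, h3, norm_mul, Real.norm_of_nonneg (NNReal.coe_nonneg _)]
      exact mul_le_mul_of_nonneg_left h4 (NNReal.coe_nonneg _)
  rw [continuous_iff_continuousAt]
  intro p
  by_cases hp : p.1 + p.2 = 0
  · obtain ⟨h1, h2⟩ := add_eq_zero.mp hp
    obtain rfl : p = (0, 0) := Prod.ext h1 h2
    obtain ⟨M, hM⟩ := hbd
    have h0 : Φ.symbol (0, 0) = 0 := by simpa using hhom 0 0 0
    rw [ContinuousAt, h0]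
    refine squeeze_zero_norm hM ?_
    have : Continuous fun p : ℝ≥0 × ℝ≥0 => ((p.1 + p.2 : ℝ≥0) : ℝ) * M := by fun_prop
    simpa using this.tendsto (0, 0)
  · exact hpos p (pos_iff_ne_zero.mpr hp)

end Symbol

/-! ### Finite-rank compressions -/

section Compression

variable {H : Type u} [NormedAddCommGroup H] [InnerProductSpace ℂ H] [CompleteSpace H]
variable {Φ : Operation.{u}}

/-- The positive operator `P S P + (1 - P)`, where `P` is the projection onto `U`. -/
noncomputable def PosOp.compressAddCompl (S : PosOp H) (U : Submodule ℂ H)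
    [U.HasOrthogonalProjection] : PosOp H :=
  ⟨(S.conj U.starProjection).1 + (1 - U.starProjection), (S.conj U.starProjection).2.add
    (ContinuousLinearMap.IsPositive.of_isStarProjection isStarProjection_starProjection.one_sub)⟩

/-- Correcting PSP by 1 - P keeps the sum equal to 1, so that (c) applies with ε = 1, while PRP
stays compact. -/
theorem compress_add_compressAddCompl {R S : PosOp H} (h : R.1 + S.1 = 1) (U : Submodule ℂ H)
    [U.HasOrthogonalProjection] :
    (R.conj U.starProjection).1 + (S.compressAddCompl U).1 = 1 := by
  have hP : U.starProjection * U.starProjection = U.starProjection :=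
    isStarProjection_starProjection.isIdempotentElem
  simp only [PosOp.compressAddCompl]
  rw [PosOp.conj_val_of_isSelfAdjoint _ (isSelfAdjoint_starProjection U),
    PosOp.conj_val_of_isSelfAdjoint _ (isSelfAdjoint_starProjection U), ← add_assoc, ← add_mul,
    ← mul_add, h, mul_one, hP, add_sub_cancel]

theorem PosOp.isCompactOperator_compress (R : PosOp H) (U : Submodule ℂ H)
    [FiniteDimensional ℂ U] : IsCompactOperator (R.conj U.starProjection).1 := by
  have h1 : IsCompactOperator U.orthogonalProjectionOnto :=
    isCompactOperator_of_locallyCompactSpace_dom _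
  have h2 : IsCompactOperator (ContinuousLinearMap.adjoint U.starProjection ∘L R.1 ∘L U.subtypeL
    ∘L U.orthogonalProjectionOnto) := h1.clm_comp
      (ContinuousLinearMap.adjoint U.starProjection ∘L R.1 ∘L U.subtypeL)
  exact h2

theorem apply_eq_jointCalculus_of_projections (hΦ : RespectsDirectSums Φ)
    (hΦ' : OperatorHomogeneous Φ) (hc : SOTContinuousBoundedBelow Φ) {R S : PosOp H}
    (hRS : R.1 + S.1 = 1) (U : ℕ → Submodule ℂ H) [∀ n, FiniteDimensional ℂ (U n)]
    (hU : Monotone U) (htop : ⊤ ≤ (⨆ n, U n).topologicalClosure) :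
    (Φ H R S).1 = jointCalculus Φ.symbol R S := by
  have hs := continuous_symbol hΦ' hc
  have hP : TendstoSOT (fun n => (U n).starProjection) atTop 1 := fun x =>
    Submodule.starProjection_tendsto_self U hU x htop
  have hPs := fun n => isSelfAdjoint_starProjection (U n)
  have hconj : ∀ Z : PosOp H, TendstoSOT (fun n => (Z.conj (U n).starProjection).1) atTop Z.1 := by
    intro Z
    have := (tendstoSOT_const (l := atTop) (ι := ℕ) Z.1).conj (A' := Z) hP hPs (IsSelfAdjoint.one _)
    rwa [PosOp.conj_val_of_isSelfAdjoint _ (IsSelfAdjoint.one _), one_mul, mul_one] at this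
  have hR := hconj R
  have hS : TendstoSOT (fun n => (S.compressAddCompl (U n)).1) atTop S.1 := by
    have := (hconj S).add ((tendstoSOT_const (1 : H →L[ℂ] H)).sub hP)
    rwa [sub_self, add_zero] at this
  have hsum := fun n => compress_add_compressAddCompl hRS (U n)
  have h1 := hc H R S _ _ 1 one_pos hR hS fun n => by
    rw [hsum, Complex.ofReal_one, one_smul]
  have h2 := tendstoSOT_jointCalculus hs (fun n => commute_of_add_eq_one (hsum n))
    (commute_of_add_eq_one hRS) (fun n => PosOp.norm_le_one_of_add_eq_one (hsum n))
    (fun n => PosOp.norm_le_one_of_add_eq_one ((add_comm _ _).trans (hsum n))) hR hS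
  simp only [fun n => apply_eq_jointCalculus_of_isCompactOperator hΦ hΦ' hs (hsum n)
    (R.isCompactOperator_compress (U n))] at h1
  exact ContinuousLinearMap.ext fun x => tendsto_nhds_unique (h1 x) (h2 x)

end Compression

/-! ### Reduction to cyclic subspaces -/

section Cyclic

variable {H : Type u} [NormedAddCommGroup H] [InnerProductSpace ℂ H]
variable {Φ : Operation.{u}}

/-- The span of the vectors `R ^ k ξ` for `k < n`. -/
def krylov (R : H →L[ℂ] H) (ξ : H) (n : ℕ) : Submodule ℂ H :=
  Submodule.span ℂ ((fun k => (R ^ k) ξ) '' Set.Iio n)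

instance (R : H →L[ℂ] H) (ξ : H) (n : ℕ) : FiniteDimensional ℂ (krylov R ξ n) :=
  FiniteDimensional.span_of_finite ℂ ((Set.finite_Iio n).image _)

theorem monotone_krylov (R : H →L[ℂ] H) (ξ : H) : Monotone (krylov R ξ) := fun _ _ h =>
  Submodule.span_mono (Set.image_mono (Set.Iio_subset_Iio h))

theorem pow_apply_mem_krylov (R : H →L[ℂ] H) (ξ : H) (k : ℕ) : (R ^ k) ξ ∈ krylov R ξ (k + 1) :=
  Submodule.subset_span ⟨k, Nat.lt_succ_self k, rfl⟩

/-- The closed cyclic subspace generated by `ξ`. -/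
def cyclicSubspace (R : H →L[ℂ] H) (ξ : H) : Submodule ℂ H :=
  (Submodule.span ℂ (Set.range fun k : ℕ => (R ^ k) ξ)).topologicalClosure

theorem pow_apply_mem_cyclicSubspace (R : H →L[ℂ] H) (ξ : H) (k : ℕ) :
    (R ^ k) ξ ∈ cyclicSubspace R ξ :=
  Submodule.le_topologicalClosure _ (Submodule.subset_span ⟨k, rfl⟩)

theorem apply_mem_cyclicSubspace (R : H →L[ℂ] H) (ξ : H) {x : H} (hx : x ∈ cyclicSubspace R ξ) :
    R x ∈ cyclicSubspace R ξ := by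
  have h : Submodule.span ℂ (Set.range fun k : ℕ => (R ^ k) ξ)
      ≤ (cyclicSubspace R ξ).comap R.toLinearMap := by
    rw [Submodule.span_le]
    rintro _ ⟨k, rfl⟩
    change R ((R ^ k) ξ) ∈ cyclicSubspace R ξ
    rw [← mul_apply_eq_comp, ← pow_succ']
    exact pow_apply_mem_cyclicSubspace R ξ (k + 1)
  have hc : IsClosed ((cyclicSubspace R ξ).comap R.toLinearMap : Set H) :=
    (Submodule.isClosed_topologicalClosure _).preimage R.continuous
  exact Submodule.topologicalClosure_minimal _ h hc hx

variable [CompleteSpace H]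

instance (R : H →L[ℂ] H) (ξ : H) : CompleteSpace (cyclicSubspace R ξ) :=
  (Submodule.isClosed_topologicalClosure _).completeSpace_coe

/-- In a nonseparable space no sequence of finite-rank projections tends to 1. But equality is
tested on one vector ξ at a time, and the closed cyclic subspace of ξ reduces both operators and is
exhausted by the Krylov subspaces. -/
theorem apply_eq_jointCalculus_of_add_eq_one (hΦ : RespectsDirectSums Φ)
    (hΦ' : OperatorHomogeneous Φ) (hc : SOTContinuousBoundedBelow Φ) {R S : PosOp H}
    (hRS : R.1 + S.1 = 1) : (Φ H R S).1 = jointCalculus Φ.symbol R S := by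
  have hs := continuous_symbol hΦ' hc
  refine ContinuousLinearMap.ext fun ξ => ?_
  let G := cyclicSubspace R.1 ξ
  have hR : ∀ x ∈ G, R.1 x ∈ G := fun x hx => apply_mem_cyclicSubspace R.1 ξ hx
  have hS : ∀ x ∈ G, S.1 x ∈ G := fun x hx => by
    have : S.1 x = x - R.1 x := by
      rw [eq_sub_iff_add_eq', ← add_apply, hRS, one_apply_eq_self]
    rw [this]
    exact G.sub_mem hx (hR x hx)
  let R' := R.conj G.subtypeL
  let S' := S.conj G.subtypeL
  have hR' : ∀ x : G, (R'.1 x : H) = R.1 x := R.conj_subtypeL_apply G hR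
  have hS' : ∀ x : G, (S'.1 x : H) = S.1 x := S.conj_subtypeL_apply G hS
  have hRS' : R'.1 + S'.1 = 1 := by
    refine ContinuousLinearMap.ext fun x => Subtype.ext ?_
    rw [add_apply, Submodule.coe_add, hR', hS', ← add_apply, hRS]
    rfl
  let ξ' : G := ⟨ξ, pow_apply_mem_cyclicSubspace R.1 ξ 0⟩
  have hpow : ∀ k : ℕ, (((R'.1 ^ k) ξ' : G) : H) = (R.1 ^ k) ξ := by
    intro k
    induction k with
    | zero => rfl
    | succ k ih =>
      rw [pow_succ', pow_succ', mul_apply_eq_comp, mul_apply_eq_comp, hR', ih]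
  -- A vector of the cyclic subspace orthogonal to every R^k ξ is orthogonal to the whole subspace,
  -- hence to itself.
  have htop : ⊤ ≤ (⨆ n, krylov R'.1 ξ' n).topologicalClosure := by
    rw [top_le_iff, Submodule.topologicalClosure_eq_top_iff, Submodule.eq_bot_iff]
    intro x hx
    have h1 : Submodule.span ℂ (Set.range fun k : ℕ => (R.1 ^ k) ξ) ≤ (ℂ ∙ (x : H))ᗮ := by
      rw [Submodule.span_le]
      rintro _ ⟨k, rfl⟩
      have h2 := hx _ (le_iSup (krylov R'.1 ξ') (k + 1) (pow_apply_mem_krylov R'.1 ξ' k))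
      rw [Submodule.coe_inner, hpow] at h2
      exact Submodule.mem_orthogonal_singleton_iff_inner_left.mpr h2
    have h3 := Submodule.topologicalClosure_minimal _ h1 (Submodule.isClosed_orthogonal _) x.2
    exact Subtype.ext (inner_self_eq_zero.mp
      (Submodule.mem_orthogonal_singleton_iff_inner_left.mp h3))
  have h1 := apply_eq_jointCalculus_of_projections hΦ hΦ' hc hRS' (krylov R'.1 ξ')
    (monotone_krylov _ _) htop
  have h2 := hΦ.apply_subtype R S G hR hS ξ'
  have h3 := jointCalculus_comp_eq_comp_jointCalculus hs (commute_of_add_eq_one hRS)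
    (commute_of_add_eq_one hRS') (W := G.subtypeL) (A := R) (B := S)
    (ContinuousLinearMap.ext fun x => (hR' x).symm) (ContinuousLinearMap.ext fun x => (hS' x).symm)
  have h4 := congrArg (fun Z : G →L[ℂ] H => Z ξ') h3
  rw [h1] at h2
  exact h2.trans h4.symm

end Cyclic

/-! ### General commuting pairs and uniqueness -/

section Commuting

variable {H : Type u} [NormedAddCommGroup H] [InnerProductSpace ℂ H] [CompleteSpace H]
variable {φ : ℝ≥0 × ℝ≥0 → ℝ} {Φ : Operation.{u}}

theorem nonneg_of_mem_spectrum {N X : H →L[ℂ] H} [IsStarNormal N] (hX : X.IsPositive) {f : ℂ → ℝ}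
    (hf : Continuous f) (h : cfc (fun z => (f z : ℂ)) N = X) {z : ℂ} (hz : z ∈ spectrum ℂ N) :
    0 ≤ f z := by
  have hf' : Continuous fun z => (f z : ℂ) := Complex.continuous_ofReal.comp hf
  have h1 : (f z : ℂ) ∈ spectrum ℂ X := by
    rw [← h, cfc_map_spectrum (fun z => (f z : ℂ)) N]
    exact ⟨z, hz, rfl⟩
  have h2 : f z ∈ spectrum ℝ X := (spectrum.algebraMap_mem_iff ℂ).mp h1
  exact spectrum_nonneg_of_nonneg ((ContinuousLinearMap.nonneg_iff_isPositive X).mpr hX) h2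

theorem cfc_re_add_I_smul {A B : H →L[ℂ] H} (hA : IsSelfAdjoint A) (hB : IsSelfAdjoint B)
    (h : Commute A B) : cfc (fun z : ℂ => (z.re : ℂ)) (A + Complex.I • B) = A := by
  have := isStarNormal_add_I_smul hA hB h
  rw [cfc_re_id (A + Complex.I • B), realPart_apply_coe, star_add_I_smul hA hB, add_add_sub_cancel, ← two_smul ℝ A,
    smul_smul]
  norm_num

theorem cfc_im_add_I_smul {A B : H →L[ℂ] H} (hA : IsSelfAdjoint A) (hB : IsSelfAdjoint B)
    (h : Commute A B) : cfc (fun z : ℂ => (z.im : ℂ)) (A + Complex.I • B) = B := by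
  have := isStarNormal_add_I_smul hA hB h
  rw [cfc_im_id (A + Complex.I • B), imaginaryPart_apply_coe, star_add_I_smul hA hB, add_sub_sub_cancel, ← two_smul ℝ,
    smul_smul, smul_comm, smul_smul]
  simp

theorem symbol_div_mul (hφ : Homogeneous φ) {x y : ℝ} (h : 0 < x + y) :
    φ ((x * (1 / (x + y))).toNNReal, (y * (1 / (x + y))).toNNReal) * (x + y)
      = φ (x.toNNReal, y.toNNReal) := by
  have h1 := hφ (x + y).toNNReal (x * (1 / (x + y))).toNNReal (y * (1 / (x + y))).toNNReal
  rw [← Real.toNNReal_mul h.le, ← Real.toNNReal_mul h.le, Real.coe_toNNReal _ h.le] at h1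
  rw [mul_comm, ← h1]
  congr 3 <;> field_simp

/-- With D² = t(N), C² = g(N) and D, C commuting with N, one has CNC = (zg)(N), so D f(CNC) D is
f(zg)t evaluated at N. -/
theorem cfc_eq_mul_cfc_mul {N C D T : H →L[ℂ] H} [IsStarNormal N] (hDD : D * D = T)
    (h1 : D * C = 1) (h2 : C * D = 1) (hDN : Commute D N) (hDN' : Commute D (star N))
    {t g f : ℂ → ℂ} (ht : Continuous t) (hg : Continuous g) (hf : Continuous f)
    (hT : cfc t N = T) (hgt : ∀ z ∈ spectrum ℂ N, g z * t z = 1)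
    (hfg : ∀ z ∈ spectrum ℂ N, f (z * g z) * t z = f z) :
    cfc f N = D * cfc f (C * N * C) * D := by
  have hgN : cfc g N = C * C := by
    have h3 : cfc g N * T = 1 := by
      rw [← hT, ← cfc_mul g t N hg.continuousOn ht.continuousOn, ← cfc_const_one ℂ N]
      exact cfc_congr hgt
    refine left_inv_eq_right_inv h3 ?_
    rw [← hDD, mul_assoc, ← mul_assoc D C, h1, one_mul, h1]
  have hCN : C * N = N * C := by
    calc C * N = C * (N * D) * C := by rw [mul_assoc, mul_assoc, h1, mul_one]
      _ = N * C := by rw [← hDN.eq, ← mul_assoc, h2, one_mul]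
  have hzg : Continuous fun z => z * g z := continuous_id.mul hg
  have hCNC : C * N * C = cfc (fun z => z * g z) N := by
    rw [cfc_mul (fun z => z) g N continuousOn_id hg.continuousOn, cfc_id' ℂ N, hgN, hCN, mul_assoc]
  have hfzg : Continuous fun z => f (z * g z) := hf.comp hzg
  have hX : cfc (fun z => f (z * g z)) N * D = D * cfc (fun z => f (z * g z)) N :=
    cfc_comp_eq_comp_cfc (N := N) (M := N) (W := D) hDN.eq.symm hDN'.eq.symm hfzg
  rw [hCNC, ← cfc_comp' f (fun z => z * g z) N hf.continuousOn hzg.continuousOn, ← hX, mul_assoc,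
    hDD, ← hT, ← cfc_mul _ t N hfzg.continuousOn ht.continuousOn]
  exact cfc_congr fun z hz => (hfg z hz).symm

/-- Homogeneity of the functional calculus of commuting pairs. -/
theorem jointCalculus_eq_mul_mul (hφ : Homogeneous φ) (hφ' : Continuous φ) {A B : PosOp H}
    (hAB : Commute A.1 B.1) {ε : ℝ} (hε : 0 < ε) (hle : (ε : ℂ) • (1 : H →L[ℂ] H) ≤ A.1 + B.1)
    {C : H →L[ℂ] H} (hC : IsSelfAdjoint C) (h1 : opSqrt (A.1 + B.1) * C = 1)
    (h2 : C * opSqrt (A.1 + B.1) = 1) :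
    jointCalculus φ A B = opSqrt (A.1 + B.1) * jointCalculus φ (A.conj C) (B.conj C)
      * opSqrt (A.1 + B.1) := by
  have hA := A.2.isSelfAdjoint
  have hB := B.2.isSelfAdjoint
  have hDD := sqrt_mul_sqrt (isPositive_sum A B)
  have hAT : Commute (A.1 + B.1) A.1 := (Commute.refl _).add_left hAB.symm
  have hBT : Commute (A.1 + B.1) B.1 := hAB.add_left (Commute.refl _)
  have hAD : Commute (opSqrt (A.1 + B.1)) A.1 :=
    sqrt_comp_eq_comp_sqrt (isPositive_sum A B) (isPositive_sum A B) hAT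
  have hBD : Commute (opSqrt (A.1 + B.1)) B.1 :=
    sqrt_comp_eq_comp_sqrt (isPositive_sum A B) (isPositive_sum A B) hBT
  generalize opSqrt (A.1 + B.1) = D at *
  have hN := isStarNormal_add_I_smul hA hB hAB
  have hre := cfc_re_add_I_smul hA hB hAB
  have him := cfc_im_add_I_smul hA hB hAB
  have hDN : Commute D (A.1 + Complex.I • B.1) := hAD.add_right (hBD.smul_right _)
  have hDN' : Commute D (star (A.1 + Complex.I • B.1)) := by
    rw [star_add_I_smul hA hB]; exact hAD.sub_right (hBD.smul_right _)
  have hM : (A.conj C).1 + Complex.I • (B.conj C).1 = C * (A.1 + Complex.I • B.1) * C := by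
    rw [PosOp.conj_val_of_isSelfAdjoint _ hC, PosOp.conj_val_of_isSelfAdjoint _ hC]
    simp only [mul_add, add_mul, mul_smul_comm, smul_mul_assoc]
  simp only [jointCalculus]
  rw [hM]
  generalize hNdef : A.1 + Complex.I • B.1 = N at *
  have hT : cfc (fun z : ℂ => ((z.re + z.im : ℝ) : ℂ)) N = A.1 + B.1 := by
    simp only [Complex.ofReal_add]
    rw [cfc_add N (fun z : ℂ => (z.re : ℂ)) (fun z : ℂ => (z.im : ℂ)), hre, him]
  have hst : ∀ z ∈ spectrum ℂ N, ε ≤ z.re + z.im := fun z hz => by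
    have h3 : cfc (fun z : ℂ => ((z.re + z.im - ε : ℝ) : ℂ)) N
        = A.1 + B.1 - (ε : ℂ) • (1 : H →L[ℂ] H) := by
      simp only [Complex.ofReal_sub]
      rw [cfc_sub (fun z : ℂ => ((z.re + z.im : ℝ) : ℂ)) (fun _ => (ε : ℂ)) N, hT,
        cfc_const (ε : ℂ) N, Algebra.algebraMap_eq_smul_one]
    have := nonneg_of_mem_spectrum (f := fun z => z.re + z.im - ε) hle (by fun_prop) h3 hz
    linarith
  -- The maximum with ε keeps g continuous on ℂ; on the spectrum g is 1/(x + y).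
  let g : ℂ → ℂ := fun z => ((1 / max ε (z.re + z.im) : ℝ) : ℂ)
  have hg : Continuous g := by
    refine Complex.continuous_ofReal.comp (Continuous.div continuous_const (by fun_prop) fun z => ?_)
    exact (lt_max_of_lt_left hε).ne'
  have hgt : ∀ z ∈ spectrum ℂ N, g z * ((z.re + z.im : ℝ) : ℂ) = 1 := fun z hz => by
    have h4 := hst z hz
    have h5 : z.re + z.im ≠ 0 := by linarith
    simp only [g, max_eq_right h4]
    rw [← Complex.ofReal_mul, one_div_mul_cancel h5, Complex.ofReal_one]
  refine cfc_eq_mul_cfc_mul hDD h1 h2 hDN hDN' (by fun_prop) hg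
    (continuous_jointCalculus_symbol hφ') hT hgt fun z hz => ?_
  have h4 := hst z hz
  simp only [g, max_eq_right h4, Complex.re_mul_ofReal, Complex.im_mul_ofReal]
  rw [← Complex.ofReal_mul, symbol_div_mul hφ (by linarith)]

/-- Conjugation by C = (A + B)^{-1/2} leads to a pair of sum 1, and Φ and the joint calculus
transform alike under it. -/
theorem apply_eq_jointCalculus_of_le (hΦ : RespectsDirectSums Φ)
    (hΦ' : OperatorHomogeneous Φ) (hc : SOTContinuousBoundedBelow Φ) {A B : PosOp H}
    (hAB : Commute A.1 B.1) {ε : ℝ} (hε : 0 < ε) (hle : (ε : ℂ) • (1 : H →L[ℂ] H) ≤ A.1 + B.1) :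
    (Φ H A B).1 = jointCalculus Φ.symbol A B := by
  obtain ⟨C, hC, h1, h2, -⟩ := exists_inverse_sqrt (isPositive_sum A B) hε hle
  rw [jointCalculus_eq_mul_mul hΦ'.homogeneous_symbol (continuous_symbol hΦ' hc) hAB hε hle hC h1
    h2, ← apply_eq_jointCalculus_of_add_eq_one hΦ hΦ' hc (conj_add_conj_eq_one hC h1 h2)]
  have h3 := hΦ' H H A B C (by
    have : Set.range C = Set.univ :=
      Set.eq_univ_of_forall fun x =>
        ⟨opSqrt (A.1 + B.1) x, congrArg (fun Z : H →L[ℂ] H => Z x) h2⟩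
    rw [this, closure_univ]
    exact Set.subset_univ _)
  rw [hC.adjoint_eq] at h3
  rw [h3]
  change _ = opSqrt (A.1 + B.1) * (C * ((Φ H A B).1 * C)) * opSqrt (A.1 + B.1)
  rw [← mul_assoc, h1, one_mul, mul_assoc, h2, mul_one]

/-- An operation with the four characteristic properties is the usual functional calculus on
commuting pairs. -/
theorem apply_eq_jointCalculus_of_commute (hΦ : RespectsDirectSums Φ)
    (hΦ' : OperatorHomogeneous Φ) (hc : SOTContinuousBoundedBelow Φ) (hd : ShiftContinuous Φ)
    {A B : PosOp H} (hAB : Commute A.1 B.1) : (Φ H A B).1 = jointCalculus Φ.symbol A B := by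
  let v : ℕ → ℝ≥0 := fun n => 1 / ((n : ℝ≥0) + 1)
  have hv : Tendsto v atTop (𝓝 0) := tendsto_one_div_add_atTop_nhds_zero_nat
  have hpos : ∀ n, 0 < v n := fun n => by positivity
  have hcomm : ∀ n, Commute (A.shift (v n)).1 (B.shift (v n)).1 := fun n =>
    (hAB.add_left ((Commute.one_left _).smul_left _)).add_right
      ((Commute.one_right _).smul_right _)
  have hA := A.tendstoSOT_shift hv
  have hB := B.tendstoSOT_shift hv
  obtain ⟨r, hr⟩ := hA.exists_norm_le
  obtain ⟨s, hs⟩ := hB.exists_norm_le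
  have h1 := tendstoSOT_jointCalculus (continuous_symbol hΦ' hc) hcomm hAB (r := max r s)
    (fun n => (hr n).trans (le_max_left _ _)) (fun n => (hs n).trans (le_max_right _ _)) hA hB
  refine ContinuousLinearMap.ext fun x => tendsto_nhds_unique
    ((hd H A B x).comp (tendsto_nhdsWithin_iff.mpr ⟨hv, Eventually.of_forall hpos⟩)) ?_
  have h2 := fun n => apply_eq_jointCalculus_of_le hΦ hΦ' hc (hcomm n) (ε := ((2 * v n : ℝ≥0) : ℝ))
    (by exact_mod_cast mul_pos two_pos (hpos n)) (A.le_shift_add_shift B (v n))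
  exact (h1 x).congr fun n => congrArg (fun Z : H →L[ℂ] H => Z x) (h2 n).symm

/-- Scalars on the line commute, and the usual calculus returns φ(x, y) there; hence uniqueness. -/
theorem IsPWCalculus.symbol_eq (hΦ : IsPWCalculus φ Φ) : φ = Φ.symbol := by
  funext p
  have hc : Commute (PosOp.scalar Line.{u} p.1).1 (PosOp.scalar Line.{u} p.2).1 :=
    ((Commute.one_left _).smul_left _)
  have h := hΦ.extends_usual Line (PosOp.scalar Line p.1) (PosOp.scalar Line p.2) hc
  rw [Φ.apply_scalar, jointCalculus_scalar φ (A := PosOp.scalar Line p.1)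
    (B := PosOp.scalar Line p.2) rfl rfl] at h
  have h1 := congrArg (fun Z : Line.{u} →L[ℂ] Line.{u} => Z Line.e PUnit.unit) h
  simp [Line.e] at h1
  exact h1.symm

end Commuting

end PW

theorem theorem10p1 (Φ : PW.Operation.{u}) :
    ((PW.OperatorHomogeneous Φ ∧ PW.RespectsDirectSums Φ ∧
        PW.SOTContinuousBoundedBelow Φ ∧ PW.ShiftContinuous Φ) ↔
      ∃ φ : ℝ≥0 × ℝ≥0 → ℝ, PW.Homogeneous φ ∧ Continuous φ ∧ PW.IsPWCalculus φ Φ) ∧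
    (∀ φ ψ : ℝ≥0 × ℝ≥0 → ℝ,
      PW.Homogeneous φ → Continuous φ → PW.IsPWCalculus φ Φ →
      PW.Homogeneous ψ → Continuous ψ → PW.IsPWCalculus ψ Φ → φ = ψ) := by
  refine ⟨⟨?_, ?_⟩, ?_⟩
  · rintro ⟨ha, hb, hc, hd⟩
    exact ⟨Φ.symbol, ha.homogeneous_symbol, PW.continuous_symbol ha hc,
      fun H _ _ _ A B hAB => PW.apply_eq_jointCalculus_of_commute hb ha hc hd hAB, ha⟩
  · rintro ⟨φ, -, hφ, hΦ⟩
    exact ⟨hΦ.homogeneous, hΦ.respectsDirectSums hφ, hΦ.sotContinuousBoundedBelow hφ,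
      hΦ.shiftContinuous hφ⟩
  · intro φ ψ _ _ hφ _ _ hψ
    rw [hφ.symbol_eq, hψ.symbol_eq]
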